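/- Let $(G,S)$ be a right-angled Coxeter system with $S$ finite, acting geometrically (properly discontinuously and cocompactly by isometries) on a proper CAT(0) space $X$, let $x_0\in X$, and let $\Lambda$ be the Cayley graph of $G$ with respect to $S$. For a geodesic ray $\alpha$ in $\Lambda$ with successive vertices $\alpha(0),\alpha(1),\dots\in G$, let $\alpha_X$ be the path in $X$ formed by the CAT(0) geodesics from $\alpha(i)x_0$ to $\alpha(i+1)x_0$, $i\ge 0$. For a geodesic ray $r:[0,\infty)\to X$ and $\delta>0$, say that $\alpha$ *$\delta$-tracks* $r$ if every point of $\alpha_X$ is within $\delta$ of a point of the image of $r$ and $d(\alpha(0)x_0,r(0))\le\delta$. Then there are constants $c,d>0$ with the following property. Let $r$ and $s$ be (unit speed) geodesic rays in $X$ with $r(0)=s(0)=x_0$, and let $M\ge 0$ and $\epsilon$ be real numbers with $d(r(M),s(M))\le\epsilon$. Then there are geodesic rays $\alpha,\beta$ in $\Lambda$ starting at $1\in G$ such that $\alpha$ $(c\epsilon+d)$-tracks $r$, $\beta$ $(c\epsilon+d)$-tracks $s$, and $\alpha$ and $\beta$ share a common initial segment out to a distance at least $M-c\epsilon-d$ from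 $x_0$; that is, for some $k\ge 0$, $\alpha(i)=\beta(i)$ for all $i\le k$, and $d(x_0,\alpha(k)x_0)\ge M-c\epsilon-d$. -/

import Mathlib

/-! ### CAT(0) spaces -/

/-- `c` restricted to `[0, D]` is a unit speed geodesic from `x` to `y`. -/
structure IsGeodesic {X : Type*} [MetricSpace X] (c : ℝ → X) (D : ℝ) (x y : X) : Prop where
  nonneg : 0 ≤ D
  source : c 0 = x
  target : c D = y
  dist_eq : ∀ t ∈ Set.Icc 0 D, ∀ t' ∈ Set.Icc 0 D, dist (c t) (c t') = |t - t'|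

/-- A (proper, geodesic) metric space is `CAT(0)` if geodesic triangles are no thicker than their
comparison triangles `a' b' c'` in the Euclidean plane. Two points on a geodesic triangle lie on
two sides issuing from a common vertex, which is called `a` here (the labelling of the vertices is
arbitrary, and a geodesic may be traversed in either direction); `p'` and `q'` are the points
corresponding to `f s` and `g t` on the sides `[a', b']` and `[a', c']`. -/
structure IsCAT0 (X : Type*) [MetricSpace X] : Prop where
  proper : ProperSpace X
  geodesic : ∀ x y : X, ∃ (D : ℝ) (c : ℝ → X), IsGeodesic c D x y
  comparison : ∀ (a b c : X) (f g : ℝ → X),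
    IsGeodesic f (dist a b) a b → IsGeodesic g (dist a c) a c →
    ∀ a' b' c' : EuclideanSpace ℝ (Fin 2),
      dist a' b' = dist a b → dist a' c' = dist a c → dist b' c' = dist b c →
      ∀ s ∈ Set.Icc 0 (dist a b), ∀ t ∈ Set.Icc 0 (dist a c),
      ∀ p' q' : EuclideanSpace ℝ (Fin 2),
        dist a' p' = s → dist p' b' = dist a b - s →
        dist a' q' = t → dist q' c' = dist a c - t →
        dist (f s) (g t) ≤ dist p' q'

/-- The action of `G` on `X` is geometric: by isometries, properly discontinuous, cocompact. -/
structure IsGeometricAction (G X : Type*) [Group G] [MetricSpace X] [MulAction G X] : Prop where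
  isometric : ∀ g : G, Isometry (fun x : X => g • x)
  proper : ProperlyDiscontinuousSMul G X
  cocompact : ∃ K : Set X, IsCompact K ∧ ∀ x : X, ∃ g : G, ∃ y ∈ K, g • y = x

/-! ### Right-angled Coxeter groups and their Cayley graphs -/

/-- Off-diagonal exponents are `2` or `∞` (the latter is encoded by `0` in a `CoxeterMatrix`). -/
def CoxeterMatrix.IsRightAngled {B : Type*} (M : CoxeterMatrix B) : Prop :=
  ∀ i j : B, i ≠ j → M i j = 2 ∨ M i j = 0

/-- The Cayley graph of `G` with respect to the Coxeter generators: `g` is adjacent to `g * s`. -/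
def CoxeterSystem.cayleyGraph {B : Type*} {M : CoxeterMatrix B} {G : Type*} [Group G]
    (cs : CoxeterSystem M G) : SimpleGraph G :=
  SimpleGraph.mulCayley (Set.range cs.simple)

/-- `α` is the sequence of vertices of a geodesic edge path ray in the graph `Λ`. -/
structure SimpleGraph.IsGeodesicRay {V : Type*} (Λ : SimpleGraph V) (α : ℕ → V) : Prop where
  adj : ∀ i, Λ.Adj (α i) (α (i + 1))
  dist_eq : ∀ i j, i ≤ j → Λ.dist (α i) (α j) = j - i

/-- The image of the piecewise geodesic `α_X` in `X` that belongs to a sequence `α` of vertices of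
the Cayley graph: the geodesics from `α i • x₀` to `α (i + 1) • x₀`, for all `i`. -/
def orbitPath {G X : Type*} [Group G] [MetricSpace X] [MulAction G X] (x₀ : X) (α : ℕ → G) :
    Set X :=
  {p | ∃ (i : ℕ) (D : ℝ) (c : ℝ → X),
    IsGeodesic c D (α i • x₀) (α (i + 1) • x₀) ∧ ∃ t ∈ Set.Icc 0 D, c t = p}

/-- The Cayley graph ray `α` `δ`-tracks the ray `r` in `X`: every point of `α_X` is within `δ` of
the image of `r`, and the initial points of `α_X` and `r` are within `δ` of each other. -/
def Tracks {G X : Type*} [Group G] [MetricSpace X] [MulAction G X] (x₀ : X) (δ : ℝ) (α : ℕ → G)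
    (r : NNReal → X) : Prop :=
  (∀ p ∈ orbitPath x₀ α, ∃ t, dist p (r t) ≤ δ) ∧ dist (α 0 • x₀) (r 0) ≤ δ

/-! A reflection `t` stands for a wall, and `cs.IsLeftInversion g t` says that this wall separates
`1` from `g`. The central consequence of right-angledness is `commute_of_quadrants`: walls that cut
the group into four nonempty quadrants have commuting reflections.

Tracking one ray (`exists_trackingRay`): a discretisation `p` of `r` in the orbit need not be
geodesic in the Cayley graph. Keep only the walls that `p` ends up beyond, each from its first
crossing on. Commutation makes the result a path `q` again, and its length never decreases. A wall
between `p l` and `q l` is crossed by `p` both before and after `l`, so its reflection moves `r` a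
bounded amount at two times around `l`, hence, by CAT(0) convexity, also in between. Proper
discontinuity bounds the number of such walls, so `q` stays near `r`.

Merging two rays: rays tracking `r` and `s` have vertices `u`, `v` near `r R`, `s R`, at word
distance linear in `ε`. By `exists_common_prefix`, `u` and `v` have a common geodesic prefix that
loses at most that many letters and stays near the given geodesic to `u`. Both rays are rerouted
through it (`exists_reroute`); up to time `R` convexity keeps `r` and `s` within `ε`, so the shared
part tracks both. -/

namespace CoxeterSystem

/-! ### Walls and the parity of their crossings. -/

open Classical in
/-- The indicator of equality, with values modulo two. -/
noncomputable def eqParity {α : Type*} (a b : α) : ZMod 2 := if a = b then 1 else 0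

theorem eqParity_congr {α : Type*} {a b c d : α} (h : a = b ↔ c = d) : eqParity a b = eqParity c d := by
  classical
  exact if_congr h rfl rfl

variable {B : Type*} {M : CoxeterMatrix B} {G : Type*} [Group G]

theorem commute_simple_of_eq_two (cs : CoxeterSystem M G) {i j : B} (h : M i j = 2) :
    cs.simple i * cs.simple j = cs.simple j * cs.simple i := by
  have := cs.simple_mul_simple_pow i j
  rw [h, pow_two] at this
  rw [eq_inv_of_mul_eq_one_left this]
  simp

/-- The action of a simple reflection on signed group elements. -/
noncomputable def signedConj (cs : CoxeterSystem M G) (i : B) (x : G × ZMod 2) : G × ZMod 2 :=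
  (cs.simple i * x.1 * cs.simple i, x.2 + eqParity x.1 (cs.simple i))

theorem involutive_signedConj (cs : CoxeterSystem M G) (i : B) :
    Function.Involutive (cs.signedConj i) := by
  rintro ⟨t, e⟩
  have h : cs.simple i * t * cs.simple i = cs.simple i ↔ t = cs.simple i := by
    constructor
    · intro h
      have h2 := congrArg (fun z => cs.simple i * z * cs.simple i) h
      simpa [mul_assoc] using h2
    · rintro rfl; simp
  simp only [signedConj]
  rw [eqParity_congr h, add_assoc, CharTwo.add_self_eq_zero, add_zero]
  simp [mul_assoc]

/-- The action of a simple reflection on signed group elements, as a permutation. -/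
noncomputable def signedPerm (cs : CoxeterSystem M G) (i : B) : Equiv.Perm (G × ZMod 2) :=
  (cs.involutive_signedConj i).toPerm

theorem signedPerm_mul_self (cs : CoxeterSystem M G) (i : B) :
    cs.signedPerm i * cs.signedPerm i = 1 := by
  ext1 x
  exact cs.involutive_signedConj i x

/-- Off the diagonal only exponent two gives a relation to check. Conjugation by one of two
commuting generators fixes the other, so the sign changes are the same in either order. -/
theorem isLiftable_signedPerm (hM : M.IsRightAngled) (cs : CoxeterSystem M G) :
    M.IsLiftable cs.signedPerm := by
  intro i j
  by_cases hij : i = j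
  · subst hij
    rw [M.diagonal, pow_one, signedPerm_mul_self]
  rcases hM i j hij with h | h
  · rw [h, pow_two]
    have hc := cs.commute_simple_of_eq_two h
    have comm : cs.signedPerm i * cs.signedPerm j = cs.signedPerm j * cs.signedPerm i := by
      ext1 x
      obtain ⟨t, e⟩ := x
      have key : ∀ a b : G, a * a = 1 → b * b = 1 → a * b = b * a → (a * t * a = b ↔ t = b) := by
        intro a b ha hb hab
        constructor
        · intro h
          have h2 := congrArg (fun z => a * z * a) h
          rw [show a * (a * t * a) * a = (a * a) * t * (a * a) by group, ha, hab,
            mul_assoc b, ha] at h2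
          simpa using h2
        · rintro rfl
          rw [hab, mul_assoc, ha, mul_one]
      change cs.signedConj i (cs.signedConj j (t, e)) = cs.signedConj j (cs.signedConj i (t, e))
      simp only [signedConj]
      rw [eqParity_congr (key _ _ (cs.simple_mul_simple_self i) (cs.simple_mul_simple_self j) hc),
        eqParity_congr (key _ _ (cs.simple_mul_simple_self j) (cs.simple_mul_simple_self i) hc.symm)]
      ext
      · simp only
        rw [show cs.simple i * (cs.simple j * t * cs.simple j) * cs.simple i
          = (cs.simple i * cs.simple j) * t * (cs.simple j * cs.simple i) by group, hc]
        rw [← hc]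
        nth_rewrite 1 [hc]
        group
      · simp only
        ring
    rw [show cs.signedPerm i * cs.signedPerm j * (cs.signedPerm i * cs.signedPerm j)
      = cs.signedPerm i * (cs.signedPerm j * cs.signedPerm i) * cs.signedPerm j by
        simp only [mul_assoc], ← comm]
    rw [← mul_assoc, signedPerm_mul_self, one_mul, signedPerm_mul_self]
  · rw [h, pow_zero]

/-- The action of the group on signed group elements. -/
noncomputable def signedHom (hM : M.IsRightAngled) (cs : CoxeterSystem M G) :
    G →* Equiv.Perm (G × ZMod 2) :=
  cs.lift ⟨cs.signedPerm, cs.isLiftable_signedPerm hM⟩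

theorem signedHom_simple (hM : M.IsRightAngled) (cs : CoxeterSystem M G) (i : B) :
    cs.signedHom hM (cs.simple i) = cs.signedPerm i :=
  cs.lift_apply_simple (cs.isLiftable_signedPerm hM) i

/-- The parity of the number of crossings of the wall of `t` on a path from `1` to `g`. -/
noncomputable def crossing (hM : M.IsRightAngled) (cs : CoxeterSystem M G) (g t : G) : ZMod 2 :=
  (cs.signedHom hM g⁻¹ (t, 0)).2

/-- The sign is only ever translated, by an amount depending on `g` and `t`; this makes `crossing` a
cocycle. -/
theorem signedHom_apply (hM : M.IsRightAngled) (cs : CoxeterSystem M G) (g t : G) (e : ZMod 2) :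
    cs.signedHom hM g (t, e) = (g * t * g⁻¹, e + (cs.signedHom hM g (t, 0)).2) := by
  induction g using cs.simple_induction_left generalizing t e with
  | one => simp
  | mul_simple_left g i ih =>
    have h : ∀ x, cs.signedHom hM (cs.simple i * g) x = cs.signedConj i (cs.signedHom hM g x) := by
      intro x
      rw [map_mul, signedHom_simple]
      rfl
    rw [h, h, ih t e, ih t 0]
    simp only [signedConj, zero_add]
    ext
    · simp [mul_assoc]
    · simp only [add_assoc]

theorem crossing_mul (hM : M.IsRightAngled) (cs : CoxeterSystem M G) (g h t : G) :
    cs.crossing hM (g * h) t = cs.crossing hM g t + cs.crossing hM h (g⁻¹ * t * g) := by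
  unfold crossing
  rw [mul_inv_rev, map_mul]
  change (cs.signedHom hM h⁻¹ (cs.signedHom hM g⁻¹ (t, 0))).2 = _
  rw [cs.signedHom_apply hM g⁻¹ t 0, cs.signedHom_apply hM h⁻¹]
  simp

theorem crossing_simple (hM : M.IsRightAngled) (cs : CoxeterSystem M G) (i : B) (t : G) :
    cs.crossing hM (cs.simple i) t = eqParity t (cs.simple i) := by
  unfold crossing
  rw [inv_simple, signedHom_simple]
  simp [signedPerm, signedConj]

theorem crossing_one (hM : M.IsRightAngled) (cs : CoxeterSystem M G) (t : G) :
    cs.crossing hM 1 t = 0 := by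
  simp [crossing]

/-- For `t = w * s * w⁻¹` the contributions of `w` and `w⁻¹` cancel, since `w * w⁻¹` crosses
nothing; the middle letter leaves a single crossing. -/
theorem crossing_self (hM : M.IsRightAngled) (cs : CoxeterSystem M G) {t : G}
    (ht : cs.IsReflection t) : cs.crossing hM t t = 1 := by
  obtain ⟨w, i, rfl⟩ := ht
  have h1 := cs.crossing_mul hM w w⁻¹ (w * cs.simple i * w⁻¹)
  rw [mul_inv_cancel, crossing_one] at h1
  rw [crossing_mul, crossing_mul, crossing_simple]
  rw [show w⁻¹ * (w * cs.simple i * w⁻¹) * w = cs.simple i by group] at h1 ⊢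
  rw [show (w * cs.simple i)⁻¹ * (w * cs.simple i * w⁻¹) * (w * cs.simple i) = cs.simple i by
    simp [mul_assoc]]
  rw [eqParity, if_pos rfl, add_right_comm, ← h1, zero_add]

theorem mem_leftInvSeq_of_crossing (hM : M.IsRightAngled) (cs : CoxeterSystem M G)
    (ω : List B) {t : G} (h : cs.crossing hM (cs.wordProd ω) t ≠ 0) : t ∈ cs.leftInvSeq ω := by
  induction ω generalizing t with
  | nil => simp [crossing_one] at h
  | cons i ω ih =>
    rw [wordProd_cons, crossing_mul, crossing_simple] at h
    rw [leftInvSeq, List.mem_cons]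
    by_cases hti : t = cs.simple i
    · exact Or.inl hti
    · rw [eqParity, if_neg hti, zero_add] at h
      refine Or.inr (List.mem_map.2 ⟨_, ih h, ?_⟩)
      simp [mul_assoc]

theorem isLeftInversion_iff_crossing (hM : M.IsRightAngled) (cs : CoxeterSystem M G) (g t : G) :
    cs.IsLeftInversion g t ↔ cs.crossing hM g t = 1 := by
  have key : ∀ g, cs.crossing hM g t = 1 → cs.IsLeftInversion g t := by
    intro g hg
    obtain ⟨ω, hω, rfl⟩ := cs.exists_isReduced g
    exact cs.isLeftInversion_of_mem_leftInvSeq hω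
      (cs.mem_leftInvSeq_of_crossing hM ω (by rw [hg]; decide))
  refine ⟨fun h => ?_, key g⟩
  by_contra hne
  have h0 : cs.crossing hM g t = 0 := by
    generalize cs.crossing hM g t = e at hne
    revert e; decide
  -- If `g` has even parity then `t * g` has odd parity, so `t` shortens `t * g`; it cannot shorten
  -- `g` as well.
  have h1 : cs.crossing hM (t * g) t = 1 := by
    rw [crossing_mul, crossing_self hM cs h.1]
    simp [h0]
  exact h.1.isLeftInversion_mul_right_iff.1 (key _ h1) h

/-- The cocycle identity for walls, from which the later combinatorics is derived: a wall separates
the ends of a concatenated path exactly when it separates the ends of one of the two pieces. -/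
theorem isLeftInversion_mul_iff (hM : M.IsRightAngled) (cs : CoxeterSystem M G) (g h t : G) :
    cs.IsLeftInversion (g * h) t ↔
      ¬ (cs.IsLeftInversion g t ↔ cs.IsLeftInversion h (g⁻¹ * t * g)) := by
  rw [isLeftInversion_iff_crossing hM, isLeftInversion_iff_crossing hM,
    isLeftInversion_iff_crossing hM, crossing_mul]
  generalize cs.crossing hM g t = a
  generalize cs.crossing hM h _ = b
  revert a b
  decide

theorem isLeftInversion_simple_iff (hM : M.IsRightAngled) (cs : CoxeterSystem M G) (i : B) (t : G) :
    cs.IsLeftInversion (cs.simple i) t ↔ t = cs.simple i := by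
  rw [isLeftInversion_iff_crossing hM, crossing_simple]
  simp [eqParity]

theorem not_isLeftInversion_one (cs : CoxeterSystem M G) (t : G) : ¬ cs.IsLeftInversion 1 t := by
  simp [IsLeftInversion]

theorem isLeftInversion_mul_simple_iff (hM : M.IsRightAngled) (cs : CoxeterSystem M G)
    (g : G) (i : B) (t : G) :
    cs.IsLeftInversion (g * cs.simple i) t ↔
      ¬ (cs.IsLeftInversion g t ↔ t = g * cs.simple i * g⁻¹) := by
  rw [isLeftInversion_mul_iff hM, isLeftInversion_simple_iff hM]
  have : g⁻¹ * t * g = cs.simple i ↔ t = g * cs.simple i * g⁻¹ := by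
    constructor
    · intro h; rw [← h]; group
    · rintro rfl; group
  rw [this]

theorem isLeftInversion_simple_mul_iff (hM : M.IsRightAngled) (cs : CoxeterSystem M G)
    (g : G) (i : B) (t : G) :
    cs.IsLeftInversion (cs.simple i * g) t ↔
      ¬ (t = cs.simple i ↔ cs.IsLeftInversion g (cs.simple i * t * cs.simple i)) := by
  rw [isLeftInversion_mul_iff hM, isLeftInversion_simple_iff hM, inv_simple]

theorem isLeftInversion_wordProd_iff (hM : M.IsRightAngled) (cs : CoxeterSystem M G)
    {ω : List B} (hω : cs.IsReduced ω) (t : G) :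
    cs.IsLeftInversion (cs.wordProd ω) t ↔ t ∈ cs.leftInvSeq ω :=
  ⟨fun h => cs.mem_leftInvSeq_of_crossing hM ω
    (by rw [(cs.isLeftInversion_iff_crossing hM _ _).1 h]; decide),
    cs.isLeftInversion_of_mem_leftInvSeq hω⟩

theorem length_le_ncard_of_isLeftInversion (hM : M.IsRightAngled) (cs : CoxeterSystem M G)
    (g : G) {A : Set G} (hA : A.Finite) (h : ∀ t, cs.IsLeftInversion g t → t ∈ A) :
    cs.length g ≤ A.ncard := by
  classical
  obtain ⟨ω, hω, rfl⟩ := cs.exists_isReduced g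
  rw [hω.eq, ← cs.length_leftInvSeq, ← List.toFinset_card_of_nodup hω.nodup_leftInvSeq,
    ← Set.ncard_coe_finset]
  refine Set.ncard_le_ncard ?_ hA
  intro t ht
  exact h t ((cs.isLeftInversion_wordProd_iff hM hω t).2 (by simpa using ht))

theorem eq_of_isLeftInversion_iff (hM : M.IsRightAngled) (cs : CoxeterSystem M G) {g h : G}
    (H : ∀ t, cs.IsLeftInversion g t ↔ cs.IsLeftInversion h t) : g = h := by
  have : cs.length (g⁻¹ * h) ≤ (∅ : Set G).ncard := by
    refine cs.length_le_ncard_of_isLeftInversion hM _ Set.finite_empty ?_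
    intro t ht
    have h1 := cs.isLeftInversion_mul_iff hM g (g⁻¹ * h) (g * t * g⁻¹)
    rw [mul_inv_cancel_left, show g⁻¹ * (g * t * g⁻¹) * g = t by group, ← H] at h1
    tauto
  rw [Set.ncard_empty, Nat.le_zero, length_eq_zero_iff] at this
  exact (inv_mul_eq_one.1 this)

theorem length_mul_simple_lt_iff (cs : CoxeterSystem M G) (g : G) (i : B) :
    cs.length (g * cs.simple i) < cs.length g ↔
      cs.IsLeftInversion g (g * cs.simple i * g⁻¹) := by
  unfold IsLeftInversion
  rw [inv_mul_cancel_right]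
  exact ⟨fun h => ⟨⟨g, i, rfl⟩, h⟩, fun h => h.2⟩

/-! ### Descents of right-angled Coxeter groups commute -/

/-- Killing all other generators maps the group to the infinite dihedral group `DihedralGroup 0`,
where the product becomes the rotation `r 1` of infinite order. -/
theorem pow_simple_mul_simple_ne_one (hM : M.IsRightAngled) (cs : CoxeterSystem M G) {i j : B}
    (h0 : M i j = 0) {n : ℕ} (hn : n ≠ 0) : (cs.simple i * cs.simple j) ^ n ≠ 1 := by
  classical
  have hij : i ≠ j := by
    rintro rfl
    simp at h0
  let f : B → DihedralGroup 0 := fun a =>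
    if a = i then DihedralGroup.sr 0 else if a = j then DihedralGroup.sr 1 else 1
  have hfi : f i = DihedralGroup.sr 0 := if_pos rfl
  have hfj : f j = DihedralGroup.sr 1 := by simp [f, hij.symm]
  have hfo : ∀ a, a ≠ i → a ≠ j → f a = 1 := fun a h1 h2 => by simp [f, h1, h2]
  have hsq : ∀ a, f a * f a = 1 := by
    intro a
    by_cases h1 : a = i
    · subst h1; rw [hfi]; simp
    by_cases h2 : a = j
    · subst h2; rw [hfj]; simp
    rw [hfo a h1 h2, one_mul]
  have hf : M.IsLiftable f := by
    intro a b
    by_cases hab : a = b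
    · subst hab; rw [M.diagonal, pow_one, hsq]
    rcases hM a b hab with h | h
    · rw [h, pow_two]
      have : f a = 1 ∨ f b = 1 := by
        by_contra hcon
        push Not at hcon
        have ha : a = i ∨ a = j := by
          by_contra hc; push Not at hc; exact hcon.1 (hfo a hc.1 hc.2)
        have hb : b = i ∨ b = j := by
          by_contra hc; push Not at hc; exact hcon.2 (hfo b hc.1 hc.2)
        have h0' : M j i = 0 := by rw [M.symmetric]; exact h0
        rcases ha with rfl | rfl <;> rcases hb with rfl | rfl <;> simp_all
      rcases this with h | h
      · rw [h, one_mul, hsq]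
      · rw [h, mul_one, hsq]
    · rw [h, pow_zero]
  intro h
  have h2 := congrArg (cs.lift ⟨f, hf⟩) h
  rw [map_pow, map_mul, map_one, cs.lift_apply_simple hf, cs.lift_apply_simple hf, hfi, hfj] at h2
  rw [DihedralGroup.sr_mul_sr, sub_zero] at h2
  have h3 := orderOf_dvd_of_pow_eq_one h2
  rw [DihedralGroup.orderOf_r_one, zero_dvd_iff] at h3
  exact hn h3

/-- The element `d` is a projection of `g` to `D`: reflections in `D` that shorten `g` are stripped
from its left until none is left. -/
theorem exists_mem_closure_isLeftInversion_iff (hM : M.IsRightAngled) (cs : CoxeterSystem M G)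
    (D : Subgroup G) (g : G) :
    ∃ d ∈ D, ∀ u ∈ D, (cs.IsLeftInversion g u ↔ cs.IsLeftInversion d u) := by
  induction hn : cs.length g using Nat.strong_induction_on generalizing g with
  | _ n ih =>
    by_cases h : ∃ r ∈ D, cs.IsLeftInversion g r
    · obtain ⟨r, hr, hgr⟩ := h
      obtain ⟨d, hd, H⟩ := ih _ (hn ▸ hgr.2) (r * g) rfl
      refine ⟨r * d, D.mul_mem hr hd, fun u hu => ?_⟩
      have e : g = r * (r * g) := by rw [← mul_assoc, hgr.1.mul_self, one_mul]
      rw [e, cs.isLeftInversion_mul_iff hM r (r * g), cs.isLeftInversion_mul_iff hM r d,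
        H _ (D.mul_mem (D.mul_mem (D.inv_mem hr) hu) hr)]
    · push Not at h
      refine ⟨1, D.one_mem, fun u hu => ?_⟩
      have := cs.not_isLeftInversion_one u
      have := h u hu
      tauto

/-- If an alternating word starting with `i` crossed the wall of `j`, a nontrivial power of `z`
would be trivial. -/
theorem not_isLeftInversion_pow (hM : M.IsRightAngled) (cs : CoxeterSystem M G) {i j : B}
    (h0 : M i j = 0) (n : ℕ) :
    ¬ cs.IsLeftInversion ((cs.simple i * cs.simple j) ^ n) (cs.simple j) ∧
      ¬ cs.IsLeftInversion ((cs.simple i * cs.simple j) ^ n * cs.simple i) (cs.simple j) := by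
  set z := cs.simple i * cs.simple j with hz
  have hconj : ∀ n : ℕ, cs.simple j * z ^ n = (z ^ n)⁻¹ * cs.simple j := by
    intro n
    induction n with
    | zero => simp
    | succ n ih =>
      rw [pow_succ, ← mul_assoc, ih, mul_inv_rev, mul_assoc, mul_assoc]
      have : cs.simple j * z = z⁻¹ * cs.simple j := by simp [hz, mul_assoc]
      rw [this, ← mul_assoc, ← mul_assoc, ← mul_inv_rev, ← mul_inv_rev, ← pow_succ, ← pow_succ']
  have hne : ∀ n : ℕ, (z ^ n)⁻¹ * cs.simple j * z ^ n ≠ cs.simple i := by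
    intro n h
    rw [mul_assoc, hconj] at h
    have h1 : z ^ (2 * n + 1) = 1 := by
      have h2 : cs.simple i * cs.simple i = 1 := by simp
      nth_rewrite 1 [← h] at h2
      rw [← inv_eq_one, pow_succ, two_mul, pow_add]
      rw [← inv_eq_one] at h2
      simp only [mul_inv_rev, inv_inv, inv_simple] at h2
      have h3 := congrArg (fun x => (z ^ n * z ^ n)⁻¹ * x * (z ^ n * z ^ n)) h2
      rw [mul_one, inv_mul_cancel] at h3
      rw [← mul_assoc, ← mul_assoc, ← hz] at h2
      have h6 : z * (z ^ n * z ^ n) = 1 := by rw [← mul_assoc]; exact h2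
      rw [inv_eq_one, ← pow_add, ← pow_succ, pow_succ', pow_add, h6]
    exact cs.pow_simple_mul_simple_ne_one hM h0 (by omega) h1
  have hne2 : ∀ n : ℕ, (z ^ n)⁻¹ * cs.simple j * z ^ n ≠
      cs.simple i * cs.simple j * cs.simple i := by
    intro n h
    have h4 : cs.simple i * cs.simple j * cs.simple i = z * z * cs.simple j := by
      simp [hz, mul_assoc]
    rw [h4, mul_assoc, hconj, ← mul_assoc] at h
    have h5 := mul_right_cancel h
    refine cs.pow_simple_mul_simple_ne_one hM h0 (n := 2 * n + 2) (by omega) ?_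
    rw [← hz, two_mul, pow_add, pow_add, pow_two, ← h5]
    group
  have main : ¬ cs.IsLeftInversion (z ^ n) (cs.simple j) := by
    induction n with
    | zero => rw [pow_zero]; exact cs.not_isLeftInversion_one _
    | succ n ih =>
      rw [pow_succ, isLeftInversion_mul_iff hM]
      have : ¬ cs.IsLeftInversion z ((z ^ n)⁻¹ * cs.simple j * z ^ n) := by
        rw [hz, isLeftInversion_mul_simple_iff hM, isLeftInversion_simple_iff hM, ← hz, inv_simple]
        have := hne n
        have := hne2 n
        tauto
      tauto
  refine ⟨main, ?_⟩
  rw [isLeftInversion_mul_iff hM, isLeftInversion_simple_iff hM]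
  have := hne n
  tauto

/-- Otherwise the two generate an infinite dihedral group. Projecting `g` there gives an alternating
word, and no such word has both letters as left inversions. -/
theorem commute_of_isLeftInversion (hM : M.IsRightAngled) (cs : CoxeterSystem M G) {i j : B}
    {g : G} (hi : cs.IsLeftInversion g (cs.simple i)) (hj : cs.IsLeftInversion g (cs.simple j)) :
    Commute (cs.simple i) (cs.simple j) := by
  by_cases hij : i = j
  · subst hij; exact Commute.refl _
  rcases hM i j hij with h | h0
  · exact cs.commute_simple_of_eq_two h
  exfalso
  have h0' : M j i = 0 := by rw [M.symmetric]; exact h0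
  let D := Subgroup.closure ({cs.simple i, cs.simple j} : Set G)
  have hiD : cs.simple i ∈ D := Subgroup.subset_closure (by simp)
  have hjD : cs.simple j ∈ D := Subgroup.subset_closure (by simp)
  obtain ⟨d, hd, H⟩ := cs.exists_mem_closure_isLeftInversion_iff hM D g
  rw [H _ hiD] at hi
  rw [H _ hjD] at hj
  have form : ∀ d ∈ D, ∃ n : ℕ, d = (cs.simple i * cs.simple j) ^ n ∨
      d = (cs.simple i * cs.simple j) ^ n * cs.simple i ∨
      d = (cs.simple j * cs.simple i) ^ n ∨
      d = (cs.simple j * cs.simple i) ^ n * cs.simple j := by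
    have step : ∀ a b : B, ∀ d : G, (∃ n : ℕ, d = (cs.simple a * cs.simple b) ^ n ∨
      d = (cs.simple a * cs.simple b) ^ n * cs.simple a ∨
      d = (cs.simple b * cs.simple a) ^ n ∨
      d = (cs.simple b * cs.simple a) ^ n * cs.simple b) →
      (∃ n : ℕ, d * cs.simple a = (cs.simple a * cs.simple b) ^ n ∨
      d * cs.simple a = (cs.simple a * cs.simple b) ^ n * cs.simple a ∨
      d * cs.simple a = (cs.simple b * cs.simple a) ^ n ∨
      d * cs.simple a = (cs.simple b * cs.simple a) ^ n * cs.simple b) := by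
      rintro a b d ⟨n, rfl | rfl | rfl | rfl⟩
      · exact ⟨n, by simp⟩
      · exact ⟨n, by simp⟩
      · cases n with
        | zero => exact ⟨0, by simp⟩
        | succ n => exact ⟨n, by simp [pow_succ, mul_assoc]⟩
      · exact ⟨n + 1, by simp [pow_succ, mul_assoc]⟩
    have swap : ∀ d : G, (∃ n : ℕ, d = (cs.simple j * cs.simple i) ^ n ∨
      d = (cs.simple j * cs.simple i) ^ n * cs.simple j ∨
      d = (cs.simple i * cs.simple j) ^ n ∨
      d = (cs.simple i * cs.simple j) ^ n * cs.simple i) ↔ (∃ n : ℕ, d = (cs.simple i * cs.simple j) ^ n ∨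
      d = (cs.simple i * cs.simple j) ^ n * cs.simple i ∨
      d = (cs.simple j * cs.simple i) ^ n ∨
      d = (cs.simple j * cs.simple i) ^ n * cs.simple j) := by
      intro d
      refine exists_congr fun n => ?_
      tauto
    intro d hd
    induction hd using Subgroup.closure_induction_right with
    | one => exact ⟨0, by simp⟩
    | mul_right x hx y hy ih =>
      rcases hy with rfl | rfl
      · exact step i j x ih
      · exact (swap _).1 (step j i x ((swap _).2 ih))
    | mul_inv_cancel x hx y hy ih =>
      rcases hy with rfl | rfl
      · rw [inv_simple]; exact step i j x ih
      · rw [inv_simple]; exact (swap _).1 (step j i x ((swap _).2 ih))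
  obtain ⟨n, rfl | rfl | rfl | rfl⟩ := form d hd
  · exact (cs.not_isLeftInversion_pow hM h0 n).1 hj
  · exact (cs.not_isLeftInversion_pow hM h0 n).2 hj
  · exact (cs.not_isLeftInversion_pow hM h0' n).1 hi
  · exact (cs.not_isLeftInversion_pow hM h0' n).2 hi

end CoxeterSystem

namespace CoxeterSystem

variable {B : Type*} {M : CoxeterMatrix B} {G : Type*} [Group G]

/-! ### Crossing walls commute -/

theorem IsReduced.of_cons {cs : CoxeterSystem M G} {i : B} {ω : List B}
    (h : cs.IsReduced (i :: ω)) : cs.IsReduced ω := by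
  simpa using h.drop 1

theorem IsReduced.isLeftInversion_cons {cs : CoxeterSystem M G} {i : B} {ω : List B}
    (h : cs.IsReduced (i :: ω)) : cs.IsLeftInversion (cs.wordProd (i :: ω)) (cs.simple i) :=
  cs.isLeftInversion_of_mem_leftInvSeq h (by simp [leftInvSeq])

theorem IsReduced.not_isLeftInversion_tail {cs : CoxeterSystem M G} {i : B} {ω : List B}
    (h : cs.IsReduced (i :: ω)) : ¬ cs.IsLeftInversion (cs.wordProd ω) (cs.simple i) := by
  rintro ⟨-, h2⟩
  rw [← wordProd_cons, h.eq, h.of_cons.eq, List.length_cons] at h2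
  omega

/-- The word runs alongside the wall of `i`. Its first letter and `i` are both left inversions of
the product in `h`, so they commute, and the first letter can be peeled off. -/
theorem IsReduced.eq_and_commute_of_mul_eq (hM : M.IsRightAngled) {cs : CoxeterSystem M G}
    {ω : List B} (hω : cs.IsReduced ω) {i j : B}
    (h : cs.simple i * cs.wordProd ω = cs.wordProd ω * cs.simple j)
    (hi : ¬ cs.IsLeftInversion (cs.wordProd ω) (cs.simple i)) :
    cs.simple i = cs.simple j ∧ ∀ c ∈ ω, Commute (cs.simple c) (cs.simple i) := by
  induction ω with
  | nil => simpa using h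
  | cons c ω ih =>
    have hc := hω.isLeftInversion_cons
    have hci : cs.simple c ≠ cs.simple i := by
      intro e; rw [e] at hc; exact hi hc
    have h1 : cs.IsLeftInversion (cs.simple i * cs.wordProd (c :: ω)) (cs.simple i) := by
      rw [isLeftInversion_simple_mul_iff hM]
      simpa using hi
    have h2 : cs.IsLeftInversion (cs.simple i * cs.wordProd (c :: ω)) (cs.simple c) := by
      rw [h, isLeftInversion_mul_simple_iff hM, ← h, mul_inv_cancel_right]
      tauto
    have hcomm := cs.commute_of_isLeftInversion hM h2 h1
    have h3 : ¬ cs.IsLeftInversion (cs.wordProd ω) (cs.simple i) := by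
      rw [wordProd_cons, isLeftInversion_simple_mul_iff hM] at hi
      have : cs.simple c * cs.simple i * cs.simple c = cs.simple i := by
        rw [hcomm.eq, mul_assoc, simple_mul_simple_self, mul_one]
      rw [this] at hi
      have := hci.symm
      tauto
    have h4 : cs.simple i * cs.wordProd ω = cs.wordProd ω * cs.simple j := by
      rw [wordProd_cons, ← mul_assoc, ← hcomm.eq, mul_assoc, mul_assoc] at h
      exact mul_left_cancel h
    obtain ⟨h5, h6⟩ := ih hω.of_cons h4 h3
    refine ⟨h5, ?_⟩
    intro d hd
    rcases List.mem_cons.1 hd with rfl | hd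
    · exact hcomm
    · exact h6 d hd

theorem commute_wordProd (cs : CoxeterSystem M G) {ω : List B} {t : G}
    (h : ∀ c ∈ ω, Commute (cs.simple c) t) : Commute (cs.wordProd ω) t := by
  induction ω with
  | nil => simp
  | cons c ω ih =>
    rw [wordProd_cons]
    exact (h c (by simp)).mul_left (ih fun d hd => h d (by simp [hd]))

theorem commute_of_isLeftInversion_of_mul_eq (hM : M.IsRightAngled) (cs : CoxeterSystem M G)
    {x : G} {i j : B} (h : cs.simple i * x = x * cs.simple j)
    (hi : ¬ cs.IsLeftInversion x (cs.simple i)) {t : G} (ht : cs.IsLeftInversion x t) :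
    Commute t (cs.simple i) := by
  obtain ⟨ω, hω, rfl⟩ := cs.exists_isReduced x
  have hc := (hω.eq_and_commute_of_mul_eq hM h hi).2
  rw [isLeftInversion_wordProd_iff hM cs hω] at ht
  obtain ⟨k, hk, rfl⟩ := List.mem_iff_getElem.1 ht
  rw [length_leftInvSeq] at hk
  rw [cs.getElem_leftInvSeq ω k hk]
  have hp : Commute (cs.wordProd (ω.take k)) (cs.simple i) :=
    cs.commute_wordProd fun c hcm => hc c (List.mem_of_mem_take hcm)
  exact (hp.mul_left (hc _ (List.getElem_mem hk))).mul_left hp.inv_left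

/-- A reduced word from `a` to `b` crosses each wall at most once, so it never crosses `t`; the edge
where it crosses `t'` lies on the side of `a`. -/
theorem exists_edge_of_isLeftInversion (hM : M.IsRightAngled) (cs : CoxeterSystem M G)
    {a b t t' : G} (hab : cs.IsLeftInversion a t ↔ cs.IsLeftInversion b t)
    (ha : ¬ cs.IsLeftInversion a t') (hb : cs.IsLeftInversion b t') :
    ∃ h i, (cs.IsLeftInversion h t ↔ cs.IsLeftInversion a t) ∧ ¬ cs.IsLeftInversion h t' ∧
      t' = h * cs.simple i * h⁻¹ := by
  obtain ⟨ω, hω, hωe⟩ := cs.exists_isReduced (a⁻¹ * b)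
  obtain rfl : b = a * cs.wordProd ω := by rw [← hωe]; group
  clear hωe
  induction ω generalizing a with
  | nil => simp at hb; exact absurd hb ha
  | cons c ω ih =>
    by_cases h1 : t' = a * cs.simple c * a⁻¹
    · exact ⟨a, c, Iff.rfl, ha, h1⟩
    have h2 : t ≠ a * cs.simple c * a⁻¹ := by
      rintro rfl
      rw [isLeftInversion_mul_iff hM] at hab
      have := hω.isLeftInversion_cons
      rw [show a⁻¹ * (a * cs.simple c * a⁻¹) * a = cs.simple c by group] at hab
      tauto
    have h3 : cs.IsLeftInversion (a * cs.simple c) t ↔ cs.IsLeftInversion a t := by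
      rw [isLeftInversion_mul_simple_iff hM]; tauto
    have h4 : cs.IsLeftInversion (a * cs.simple c) t' ↔ cs.IsLeftInversion a t' := by
      rw [isLeftInversion_mul_simple_iff hM]; tauto
    rw [wordProd_cons, ← mul_assoc] at hab hb
    obtain ⟨h, i, h5, h6, h7⟩ := ih (a := a * cs.simple c) (by rwa [h4]) hω.of_cons (by rw [h3, hab]) hb
    exact ⟨h, i, by rw [h5, h3], h6, h7⟩

/-- If each of the four quadrants of two walls is nonempty then their reflections commute. -/
theorem commute_of_quadrants (hM : M.IsRightAngled) (cs : CoxeterSystem M G)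
    {a b c d t t' : G}
    (ha : ¬ cs.IsLeftInversion a t) (ha' : ¬ cs.IsLeftInversion a t')
    (hb : ¬ cs.IsLeftInversion b t) (hb' : cs.IsLeftInversion b t')
    (hc : cs.IsLeftInversion c t) (hc' : ¬ cs.IsLeftInversion c t')
    (hd : cs.IsLeftInversion d t) (hd' : cs.IsLeftInversion d t') :
    Commute t t' := by
  obtain ⟨h, i, h1, h2, h3⟩ := cs.exists_edge_of_isLeftInversion hM (a := a) (b := b) (t := t)
    (by tauto) ha' hb'
  obtain ⟨k, j, k1, k2, k3⟩ := cs.exists_edge_of_isLeftInversion hM (a := c) (b := d) (t := t)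
    (by tauto) hc' hd'
  have e1 : h⁻¹ * t' * h = cs.simple i := by rw [h3]; group
  have key : ∀ u, cs.IsLeftInversion k u ↔
      ¬ (cs.IsLeftInversion h u ↔ cs.IsLeftInversion (h⁻¹ * k) (h⁻¹ * u * h)) := by
    intro u
    rw [← isLeftInversion_mul_iff hM, mul_inv_cancel_left]
  -- The edges at `h` and `k` lie in the same wall `t'`, on different sides of `t`. The path between
  -- them runs alongside `t'` and crosses `t`, so the two reflections commute.
  have e2 : cs.simple i * (h⁻¹ * k) = (h⁻¹ * k) * cs.simple j := by
    rw [← e1, k3]; group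
  have e3 : ¬ cs.IsLeftInversion (h⁻¹ * k) (cs.simple i) := by
    have := key t'
    rw [e1] at this
    tauto
  have e4 : cs.IsLeftInversion (h⁻¹ * k) (h⁻¹ * t * h) := by
    have := key t
    tauto
  have e5 := cs.commute_of_isLeftInversion_of_mul_eq hM e2 e3 e4
  rw [← e1] at e5
  have e6 := congrArg (fun z => h * z * h⁻¹) e5.eq
  rw [show h * (h⁻¹ * t * h * (h⁻¹ * t' * h)) * h⁻¹ = t * t' by group,
    show h * (h⁻¹ * t' * h * (h⁻¹ * t * h)) * h⁻¹ = t' * t by group] at e6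
  exact e6

/-- An edge can be slid along `x` without changing its label or its wall if every wall crossed on
the way commutes with that wall. Letters of a reduced word for `x` are removed from the left. -/
theorem conj_simple_eq_of_commute (hM : M.IsRightAngled) (cs : CoxeterSystem M G) {i : B} {x : G}
    (h : ∀ t, cs.IsLeftInversion x t → Commute t (x * cs.simple i * x⁻¹)) :
    x * cs.simple i * x⁻¹ = cs.simple i := by
  obtain ⟨ω, hω, rfl⟩ := cs.exists_isReduced x
  induction ω with
  | nil => simp
  | cons c ω ih =>
    set y := cs.wordProd (c :: ω) * cs.simple i * (cs.wordProd (c :: ω))⁻¹ with hy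
    have hc := h _ hω.isLeftInversion_cons
    have e : cs.wordProd ω * cs.simple i * (cs.wordProd ω)⁻¹ = y := by
      have : y = cs.simple c * (cs.wordProd ω * cs.simple i * (cs.wordProd ω)⁻¹) * cs.simple c := by
        rw [hy, wordProd_cons]; simp [mul_assoc]
      have h2 : cs.simple c * y * cs.simple c = y := by
        rw [hc.eq, mul_assoc, simple_mul_simple_self, mul_one]
      rw [← h2, this]
      simp [mul_assoc]
    rw [← e]
    refine ih hω.of_cons ?_
    intro t ht
    rw [e]
    have hne : t ≠ cs.simple c := by
      rintro rfl
      exact hω.not_isLeftInversion_tail ht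
    have h3 : cs.IsLeftInversion (cs.wordProd (c :: ω)) (cs.simple c * t * cs.simple c) := by
      rw [wordProd_cons, isLeftInversion_simple_mul_iff hM]
      have h4 : cs.simple c * (cs.simple c * t * cs.simple c) * cs.simple c = t := by
        simp [mul_assoc]
      rw [h4]
      have : cs.simple c * t * cs.simple c ≠ cs.simple c := by
        intro h5
        rw [h5] at h4
        simp at h4
        exact hne h4.symm
      tauto
    have h5 := h _ h3
    have h6 := (hc.mul_left h5).mul_left hc
    simpa [mul_assoc] using h6

/-! ### Straightening a path -/

/-- A path that may pause. -/
def IsLazyPath (cs : CoxeterSystem M G) (p : ℕ → G) : Prop :=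
  p 0 = 1 ∧ ∀ l, p (l + 1) = p l ∨ ∃ i, p (l + 1) = p l * cs.simple i

/-- The reflections in the walls that separate `1` from almost all points of `p`. -/
def eventualInversions (cs : CoxeterSystem M G) (p : ℕ → G) : Set G :=
  {t | ∃ N, ∀ l ≥ N, cs.IsLeftInversion (p l) t}

/-- Some point of `p` up to the time `l` is separated from `1` by the wall of `t`. -/
def SeparatedBefore (cs : CoxeterSystem M G) (p : ℕ → G) (l : ℕ) (t : G) : Prop :=
  ∃ j ≤ l, cs.IsLeftInversion (p j) t

/-- The wall of `t` is crossed by `p` both before and after the time `l`. -/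
def CrossedAround (cs : CoxeterSystem M G) (p : ℕ → G) (l : ℕ) (t : G) : Prop :=
  ∃ m n i j, m ≤ l ∧ l ≤ n ∧ t = p m * cs.simple i * (p m)⁻¹ ∧ t = p n * cs.simple j * (p n)⁻¹

theorem IsLazyPath.exists_crossing (hM : M.IsRightAngled) {cs : CoxeterSystem M G} {p : ℕ → G}
    (hp : cs.IsLazyPath p) {a b : ℕ} (hab : a ≤ b) {t : G}
    (h : ¬ (cs.IsLeftInversion (p a) t ↔ cs.IsLeftInversion (p b) t)) :
    ∃ m i, a ≤ m ∧ m ≤ b ∧ t = p m * cs.simple i * (p m)⁻¹ := by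
  induction b, hab using Nat.le_induction with
  | base => exact absurd Iff.rfl h
  | succ b hb ih =>
    by_cases h1 : cs.IsLeftInversion (p a) t ↔ cs.IsLeftInversion (p b) t
    · rcases hp.2 b with h2 | ⟨i, h2⟩
      · rw [h2] at h; exact absurd h1 h
      · rw [h2, isLeftInversion_mul_simple_iff hM] at h
        exact ⟨b, i, hb, b.le_succ, by tauto⟩
    · obtain ⟨m, i, h2, h3, h4⟩ := ih h1
      exact ⟨m, i, h2, h3.trans b.le_succ, h4⟩

/-- The straightened point is prescribed by its set of walls, so its existence has to be proved. It
moves only when `p` first crosses a wall that it ends up beyond; the step is the edge of `p`, slid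
from `p l` to `g`. -/
theorem IsLazyPath.exists_straightening_step (hM : M.IsRightAngled) {cs : CoxeterSystem M G}
    {p : ℕ → G} (hp : cs.IsLazyPath p) (l : ℕ) {g : G}
    (hg : ∀ t, cs.IsLeftInversion g t ↔
      cs.SeparatedBefore p l t ∧ t ∈ cs.eventualInversions p) :
    ∃ g', (g' = g ∨ ∃ i, g' = g * cs.simple i ∧ cs.length g' = cs.length g + 1) ∧
      ∀ t, cs.IsLeftInversion g' t ↔
        cs.SeparatedBefore p (l + 1) t ∧ t ∈ cs.eventualInversions p := by
  have hle : ∀ t, cs.SeparatedBefore p (l + 1) t ↔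
      cs.SeparatedBefore p l t ∨ cs.IsLeftInversion (p (l + 1)) t := by
    intro t
    constructor
    · rintro ⟨j, hj, h⟩
      rcases Nat.le_succ_iff.1 hj with hj | rfl
      · exact Or.inl ⟨j, hj, h⟩
      · exact Or.inr h
    · rintro (⟨j, hj, h⟩ | h)
      · exact ⟨j, by omega, h⟩
      · exact ⟨l + 1, le_rfl, h⟩
  rcases hp.2 l with h | ⟨i, h⟩
  · refine ⟨g, Or.inl rfl, fun t => ?_⟩
    rw [hg, hle, h]
    have : cs.IsLeftInversion (p l) t → cs.SeparatedBefore p l t :=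
      fun h => ⟨l, le_rfl, h⟩
    tauto
  set t := p l * cs.simple i * (p l)⁻¹ with ht
  have hstep : ∀ u, cs.IsLeftInversion (p (l + 1)) u ↔ ¬ (cs.IsLeftInversion (p l) u ↔ u = t) := by
    intro u
    rw [h, isLeftInversion_mul_simple_iff hM]
  by_cases hcase : t ∈ cs.eventualInversions p ∧ ¬ cs.IsLeftInversion g t
  · obtain ⟨htC, htg⟩ := hcase
    have hnot : ∀ j ≤ l, ¬ cs.IsLeftInversion (p j) t := by
      intro j hj hjt
      exact htg ((hg t).2 ⟨⟨j, hj, hjt⟩, htC⟩)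
    have h1 : ¬ cs.IsLeftInversion 1 t := cs.not_isLeftInversion_one t
    have hlt := hnot l le_rfl
    have hl1 : cs.IsLeftInversion (p (l + 1)) t := by rw [hstep]; tauto
    obtain ⟨N, hN⟩ := htC
    -- Every wall between `g` and `p l` crosses `t`: the path `p` itself, which starts at `1`,
    -- visits all four quadrants.
    have hdiff : ∀ u, ¬ (cs.IsLeftInversion g u ↔ cs.IsLeftInversion (p l) u) → Commute u t := by
      intro u hu
      have hut : u ≠ t := by
        rintro rfl; tauto
      have hu1 := cs.not_isLeftInversion_one u
      have hul := hstep u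
      by_cases hpu : cs.IsLeftInversion (p l) u
      · have hgu : ¬ cs.IsLeftInversion g u := by tauto
        have : u ∉ cs.eventualInversions p := fun hC => hgu ((hg u).2 ⟨⟨l, le_rfl, hpu⟩, hC⟩)
        simp only [eventualInversions, Set.mem_ofPred_eq, not_exists, not_forall] at this
        obtain ⟨L, hL, hLu⟩ := this N
        exact (cs.commute_of_quadrants hM h1 hu1 hlt hpu (hN L hL) hLu hl1 (by tauto)).symm
      · have hgu : cs.IsLeftInversion g u := by tauto
        obtain ⟨⟨j, hj, hju⟩, N', hN'⟩ := (hg u).1 hgu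
        exact (cs.commute_of_quadrants hM h1 hu1 (hnot j hj) hju hl1 (by tauto)
          (hN (max N N') (le_max_left _ _)) (hN' (max N N') (le_max_right _ _))).symm
    have hgt : t = g * cs.simple i * g⁻¹ := by
      have key := cs.conj_simple_eq_of_commute hM (i := i) (x := g⁻¹ * p l) ?_
      · have e := congrArg (fun z => g * z * g⁻¹) key
        rw [← e, ht]
        group
      · intro u hu
        have h2 := hdiff (g * u * g⁻¹) ?_
        · have h3 := congrArg (fun z => g⁻¹ * z * g) h2.eq
          have e1 : g⁻¹ * p l * cs.simple i * (g⁻¹ * p l)⁻¹ = g⁻¹ * t * g := by rw [ht]; group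
          rw [e1]
          change u * (g⁻¹ * t * g) = (g⁻¹ * t * g) * u
          rw [show u * (g⁻¹ * t * g) = g⁻¹ * (g * u * g⁻¹ * t) * g by group, h3]
          group
        · have := cs.isLeftInversion_mul_iff hM g (g⁻¹ * p l) (g * u * g⁻¹)
          rw [mul_inv_cancel_left, show g⁻¹ * (g * u * g⁻¹) * g = u by group] at this
          tauto
    have hg' : ∀ u, cs.IsLeftInversion (g * cs.simple i) u ↔ ¬ (cs.IsLeftInversion g u ↔ u = t) := by
      intro u
      rw [isLeftInversion_mul_simple_iff hM, ← hgt]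
    refine ⟨g * cs.simple i, Or.inr ⟨i, rfl, ?_⟩, fun u => ?_⟩
    · rcases cs.length_mul_simple g i with h2 | h2
      · exact h2
      · exact absurd ((cs.length_mul_simple_lt_iff g i).1 (by omega)) (hgt ▸ htg)
    · rw [hg', hle, hstep, hg]
      by_cases hut : u = t
      · subst hut
        have : t ∈ cs.eventualInversions p := ⟨N, hN⟩
        have h5 := hg t
        tauto
      · have : cs.IsLeftInversion (p l) u → cs.SeparatedBefore p l u :=
          fun h => ⟨l, le_rfl, h⟩
        tauto
  · refine ⟨g, Or.inl rfl, fun u => ?_⟩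
    rw [hg, hle, hstep]
    have h6 : cs.IsLeftInversion (p l) u → cs.SeparatedBefore p l u :=
      fun h => ⟨l, le_rfl, h⟩
    by_cases hut : u = t
    · subst hut
      have h5 := hg t
      tauto
    · tauto

/-- Every lazy path is near a lazy path along which the length never decreases. -/
theorem IsLazyPath.exists_straightening (hM : M.IsRightAngled) {cs : CoxeterSystem M G}
    {p : ℕ → G} (hp : cs.IsLazyPath p) :
    ∃ q : ℕ → G, q 0 = 1 ∧
      (∀ l, q (l + 1) = q l ∨
        ∃ i, q (l + 1) = q l * cs.simple i ∧ cs.length (q (l + 1)) = cs.length (q l) + 1) ∧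
      ∀ l u, cs.IsLeftInversion ((p l)⁻¹ * q l) u → cs.CrossedAround p l (p l * u * (p l)⁻¹) := by
  have main : ∀ l, ∃ g, ∀ t, cs.IsLeftInversion g t ↔
      cs.SeparatedBefore p l t ∧ t ∈ cs.eventualInversions p := by
    intro l
    induction l with
    | zero =>
      refine ⟨1, fun t => ?_⟩
      have h1 := cs.not_isLeftInversion_one t
      have h0 : ¬ cs.SeparatedBefore p 0 t := by
        rintro ⟨j, hj, h⟩
        obtain rfl := Nat.le_zero.1 hj
        rw [hp.1] at h
        exact h1 h
      tauto
    | succ l ih =>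
      obtain ⟨g, hg⟩ := ih
      obtain ⟨g', -, hg'⟩ := hp.exists_straightening_step hM l hg
      exact ⟨g', hg'⟩
  choose q hq using main
  refine ⟨q, ?_, fun l => ?_, fun l u hu => ?_⟩
  · refine cs.eq_of_isLeftInversion_iff hM fun t => ?_
    rw [hq]
    have h1 := cs.not_isLeftInversion_one t
    have h0 : ¬ cs.SeparatedBefore p 0 t := by
      rintro ⟨j, hj, h⟩
      obtain rfl := Nat.le_zero.1 hj
      rw [hp.1] at h
      exact h1 h
    tauto
  · obtain ⟨g', h1, hg'⟩ := hp.exists_straightening_step hM l (hq l)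
    obtain rfl : g' = q (l + 1) := cs.eq_of_isLeftInversion_iff hM fun t => by rw [hg', hq]
    exact h1
  · set t := p l * u * (p l)⁻¹ with ht
    have h1 : ¬ (cs.IsLeftInversion (p l) t ↔ cs.IsLeftInversion (q l) t) := by
      have := cs.isLeftInversion_mul_iff hM (p l) ((p l)⁻¹ * q l) t
      rw [mul_inv_cancel_left, show (p l)⁻¹ * t * p l = u by rw [ht]; group] at this
      tauto
    have h0 : ¬ cs.IsLeftInversion (p 0) t := by rw [hp.1]; exact cs.not_isLeftInversion_one t
    suffices H : (∃ a ≤ l, ¬ (cs.IsLeftInversion (p a) t ↔ cs.IsLeftInversion (p l) t)) ∧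
        ∃ b ≥ l, ¬ (cs.IsLeftInversion (p l) t ↔ cs.IsLeftInversion (p b) t) by
      obtain ⟨⟨a, ha, ha'⟩, b, hb, hb'⟩ := H
      obtain ⟨m, i, -, h2, h3⟩ := hp.exists_crossing hM ha ha'
      obtain ⟨n, j, h4, -, h5⟩ := hp.exists_crossing hM hb hb'
      exact ⟨m, n, i, j, h2, h4, h3, h5⟩
    -- If `p l` is beyond the wall, `p` crossed it after time `0` and must return, as the wall is
    -- not eventual. If not, `p` was beyond it earlier and ends up beyond it.
    by_cases hpt : cs.IsLeftInversion (p l) t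
    · refine ⟨⟨0, Nat.zero_le _, by tauto⟩, ?_⟩
      have : t ∉ cs.eventualInversions p := fun hC => by
        have := (hq l t).2 ⟨⟨l, le_rfl, hpt⟩, hC⟩
        tauto
      simp only [eventualInversions, Set.mem_ofPred_eq, not_exists, not_forall] at this
      obtain ⟨L, hL, hLu⟩ := this l
      exact ⟨L, hL, by tauto⟩
    · obtain ⟨⟨j, hj, hj'⟩, N, hN⟩ := (hq l t).1 (by tauto)
      refine ⟨⟨j, hj, by tauto⟩, max l N, le_max_left _ _, ?_⟩
      have := hN (max l N) (le_max_right _ _)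
      tauto

/-! ### Common initial segments -/

/-- The exchange condition with control of prefixes: the deleted letter commutes with everything
after it, so each new prefix is an old one up to that letter. -/
theorem IsReduced.exists_deletion (hM : M.IsRightAngled) {cs : CoxeterSystem M G} {ω : List B}
    (hω : cs.IsReduced ω) {i : B}
    (h : cs.length (cs.wordProd ω * cs.simple i) < cs.length (cs.wordProd ω)) :
    ∃ ω' : List B, cs.wordProd ω' = cs.wordProd ω * cs.simple i ∧ ω'.length + 1 = ω.length ∧
      ∀ n, ∃ m e, cs.length e ≤ 1 ∧ cs.wordProd (ω'.take n) = cs.wordProd (ω.take m) * e := by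
  induction ω with
  | nil => simp at h
  | cons c ω ih =>
    rw [length_mul_simple_lt_iff] at h
    by_cases hc : cs.wordProd (c :: ω) * cs.simple i * (cs.wordProd (c :: ω))⁻¹ = cs.simple c
    · have hc' : cs.simple c * cs.wordProd ω = cs.wordProd ω * cs.simple i := by
        have h2 := mul_inv_eq_iff_eq_mul.1 hc
        rw [wordProd_cons, mul_assoc] at h2
        exact (mul_left_cancel h2).symm
      have hcomm := (hω.of_cons.eq_and_commute_of_mul_eq hM hc' hω.not_isLeftInversion_tail).2
      refine ⟨ω, ?_, by simp, fun n => ⟨n + 1, cs.simple c, by simp, ?_⟩⟩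
      · rw [wordProd_cons, hc', simple_mul_simple_cancel_right]
      · have : Commute (cs.wordProd (ω.take n)) (cs.simple c) :=
          cs.commute_wordProd fun d hd => hcomm d (List.mem_of_mem_take hd)
        rw [List.take_succ_cons, wordProd_cons, mul_assoc, this.eq, simple_mul_simple_cancel_left]
    · have h2 : cs.length (cs.wordProd ω * cs.simple i) < cs.length (cs.wordProd ω) := by
        rw [length_mul_simple_lt_iff]
        nth_rewrite 1 [wordProd_cons] at h
        rw [isLeftInversion_simple_mul_iff hM] at h
        have e : cs.simple c * (cs.wordProd (c :: ω) * cs.simple i * (cs.wordProd (c :: ω))⁻¹) *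
            cs.simple c = cs.wordProd ω * cs.simple i * (cs.wordProd ω)⁻¹ := by
          rw [wordProd_cons]; simp [mul_assoc]
        rw [e] at h
        tauto
      obtain ⟨ω', h3, h4, h5⟩ := ih hω.of_cons h2
      refine ⟨c :: ω', by rw [wordProd_cons, wordProd_cons, h3, mul_assoc], by simp [h4], ?_⟩
      intro n
      cases n with
      | zero => exact ⟨0, 1, by simp, by simp⟩
      | succ n =>
        obtain ⟨m, e, h6, h7⟩ := h5 n
        exact ⟨m + 1, e, h6, by simp only [List.take_succ_cons, wordProd_cons, h7, mul_assoc]⟩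

/-- The letter `i` cancels against a letter inside `ω`, and so commutes with everything to the right
of that letter, in particular with `τ`. -/
theorem IsReduced.commute_of_append (hM : M.IsRightAngled) {cs : CoxeterSystem M G} {ω τ : List B}
    (hω : cs.IsReduced (ω ++ τ)) {i : B}
    (h : cs.length (cs.wordProd (ω ++ τ) * cs.simple i) < cs.length (cs.wordProd (ω ++ τ)))
    (hτ : ¬ cs.length (cs.wordProd τ * cs.simple i) < cs.length (cs.wordProd τ)) :
    Commute (cs.wordProd τ) (cs.simple i) := by
  induction ω with
  | nil => exact absurd h hτ
  | cons c ω ih =>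
    rw [List.cons_append] at hω h
    rw [length_mul_simple_lt_iff] at h
    set v := cs.wordProd (ω ++ τ) with hv
    have hve : cs.wordProd (c :: (ω ++ τ)) = cs.simple c * v := wordProd_cons _ _ _
    rw [hve] at h
    by_cases hc : cs.simple c * v * cs.simple i * (cs.simple c * v)⁻¹ = cs.simple c
    · have hc' : cs.simple c * v = v * cs.simple i := by
        have h2 := mul_inv_eq_iff_eq_mul.1 hc
        rw [mul_assoc] at h2
        exact (mul_left_cancel h2).symm
      obtain ⟨h1, h2⟩ := hω.of_cons.eq_and_commute_of_mul_eq hM hc' hω.not_isLeftInversion_tail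
      rw [← h1]
      exact cs.commute_wordProd fun d hd => h2 d (by simp [hd])
    · refine ih hω.of_cons ?_
      rw [length_mul_simple_lt_iff]
      rw [isLeftInversion_simple_mul_iff hM] at h
      have e : cs.simple c * (cs.simple c * v * cs.simple i * (cs.simple c * v)⁻¹) *
          cs.simple c = v * cs.simple i * v⁻¹ := by
        simp [mul_assoc]
      rw [e] at h
      tauto

/-- Two elements at distance at most `n` have a common initial segment that misses at most the last
`n` letters of the given reduced word of the first one. -/
theorem IsReduced.exists_common_prefix (hM : M.IsRightAngled) {cs : CoxeterSystem M G} {ω : List B}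
    (hω : cs.IsReduced ω) (σ : List B) :
    ∃ ω' : List B, cs.length (cs.wordProd ω) =
        ω'.length + cs.length ((cs.wordProd ω')⁻¹ * cs.wordProd ω) ∧
      cs.length (cs.wordProd ω * cs.wordProd σ) =
        ω'.length + cs.length ((cs.wordProd ω')⁻¹ * (cs.wordProd ω * cs.wordProd σ)) ∧
      ω.length ≤ ω'.length + σ.length ∧
      ∀ n, ∃ m e, cs.length e ≤ σ.length ∧
        cs.wordProd (ω'.take n) = cs.wordProd (ω.take m) * e := by
  induction σ using List.reverseRecOn with
  | nil => exact ⟨ω, by simp [hω.eq], by simp [hω.eq], by simp, fun n => ⟨n, 1, by simp, by simp⟩⟩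
  | append_singleton σ i ih =>
    obtain ⟨ω', h1, h2, h3, h4⟩ := ih
    rw [wordProd_append, wordProd_singleton, ← mul_assoc, List.length_append, List.length_singleton]
    set u := cs.wordProd ω with hu
    set v := u * cs.wordProd σ with hv
    set m := cs.wordProd ω' with hm
    have hm_len : cs.length m ≤ ω'.length := cs.length_wordProd_le ω'
    have h4' : ∀ n, ∃ k e, cs.length e ≤ σ.length + 1 ∧
        cs.wordProd (ω'.take n) = cs.wordProd (ω.take k) * e := by
      intro n
      obtain ⟨k, e, h5, h6⟩ := h4 n
      exact ⟨k, e, by omega, h6⟩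
    have hred : cs.IsReduced ω' := by
      have := cs.length_mul_le m (m⁻¹ * u)
      rw [mul_inv_cancel_left] at this
      change cs.length m = _
      omega
    have hml := hred.eq
    rw [← hm] at hml
    obtain ⟨τ, hτ, hτe⟩ := cs.exists_isReduced (m⁻¹ * v)
    have hvm : v = m * (m⁻¹ * v) := by group
    have tri := cs.length_mul_le m (m⁻¹ * (v * cs.simple i))
    rw [mul_inv_cancel_left] at tri
    rcases cs.length_mul_simple v i with hlen | hlen
    · refine ⟨ω', h1, ?_, by omega, h4'⟩
      have := cs.length_mul_le (m⁻¹ * v) (cs.simple i)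
      rw [length_simple, mul_assoc] at this
      change _ = _ + cs.length (m⁻¹ * (v * cs.simple i))
      omega
    -- If the new letter cancels inside `τ`, the part of `v` after the common prefix, the prefix
    -- survives.
    · by_cases hw : cs.length (cs.wordProd τ * cs.simple i) < cs.length (cs.wordProd τ)
      · refine ⟨ω', h1, ?_, by omega, h4'⟩
        change _ = _ + cs.length (m⁻¹ * (v * cs.simple i))
        rw [← hτe, mul_assoc] at hw
        omega
      · have hv2 : v = cs.wordProd (ω' ++ τ) := by rw [wordProd_append, ← hτe, ← hm, ← hvm]
        have hred2 : cs.IsReduced (ω' ++ τ) := by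
          unfold IsReduced
          rw [← hv2, h2, List.length_append, hτe, hτ.eq]
        have hcomm := hred2.commute_of_append hM (i := i) (by rw [← hv2]; omega) hw
        rw [← hτe] at hcomm
        -- The new letter commutes past `τ`, so its wall at `v` is also its wall at `m`. As `τ` does
        -- not cross this wall, `m` does, and one letter of the prefix is deleted.
        have hms : cs.length (m * cs.simple i) < cs.length m := by
          by_contra hcon
          have e : v * cs.simple i = m * cs.simple i * (m⁻¹ * v) := by
            rw [mul_assoc m, ← hcomm.eq]; group
          have h8 : cs.IsLeftInversion v (v * cs.simple i * v⁻¹) :=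
            (cs.length_mul_simple_lt_iff v i).1 (by omega)
          have e2 : v * cs.simple i * v⁻¹ = m * cs.simple i * m⁻¹ := by rw [e]; group
          rw [e2, hvm, isLeftInversion_mul_iff hM,
            show m⁻¹ * (m * cs.simple i * m⁻¹) * m = cs.simple i by group] at h8
          rw [length_mul_simple_lt_iff] at hcon
          rw [length_mul_simple_lt_iff, ← hτe, hcomm.eq, mul_inv_cancel_right] at hw
          tauto
        obtain ⟨ω'', h5, h6, h7⟩ := hred.exists_deletion hM hms
        rw [← hm] at h5
        have e3 : (m * cs.simple i)⁻¹ * (v * cs.simple i) = m⁻¹ * v := by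
          rw [mul_inv_rev, inv_simple, mul_assoc, ← mul_assoc m⁻¹ v, hcomm.eq,
            simple_mul_simple_cancel_left]
        refine ⟨ω'', ?_, ?_, by omega, ?_⟩
        · rw [h5]
          have t1 := cs.length_mul_le (m * cs.simple i) ((m * cs.simple i)⁻¹ * u)
          rw [mul_inv_cancel_left] at t1
          have t2 := cs.length_mul_le (cs.simple i) (m⁻¹ * u)
          rw [length_simple] at t2
          have e4 : (m * cs.simple i)⁻¹ * u = cs.simple i * (m⁻¹ * u) := by
            rw [mul_inv_rev, inv_simple, mul_assoc]
          have t3 := cs.length_wordProd_le ω''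
          rw [h5] at t3
          rw [e4] at t1 ⊢
          omega
        · rw [h5, e3]
          omega
        · intro n
          obtain ⟨k, e, h8, h9⟩ := h7 n
          obtain ⟨k', e', h10, h11⟩ := h4 k
          refine ⟨k', e' * e, ?_, by rw [h9, h11, mul_assoc]⟩
          have := cs.length_mul_le e' e
          omega

end CoxeterSystem

namespace CoxeterSystem

variable {B : Type*} {M : CoxeterMatrix B} {G : Type*} [Group G]

/-! ### Geodesic rays in the Cayley graph -/

/-- The vertices of a geodesic ray from `1` in the Cayley graph, in terms of lengths. -/
structure IsReducedRay (cs : CoxeterSystem M G) (α : ℕ → G) : Prop where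
  step : ∀ n, ∃ i, α (n + 1) = α n * cs.simple i
  length_eq : ∀ n, cs.length (α n) = n

theorem IsReducedRay.zero {cs : CoxeterSystem M G} {α : ℕ → G} (h : cs.IsReducedRay α) :
    α 0 = 1 :=
  cs.length_eq_zero_iff.1 (h.length_eq 0)

theorem length_le_length_add_of_walk (cs : CoxeterSystem M G) {g h : G}
    (w : cs.cayleyGraph.Walk g h) : cs.length h ≤ cs.length g + w.length := by
  induction w with
  | nil => simp
  | @cons u v w hadj p ih =>
    rw [SimpleGraph.Walk.length_cons]
    have : cs.length v ≤ cs.length u + 1 := by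
      obtain ⟨-, x, ⟨i, rfl⟩, h | h⟩ := (SimpleGraph.mulCayley_adj' _ _ _).1 hadj
      · rw [← h]
        simpa using cs.length_mul_le u (cs.simple i)
      · rw [h]
        rcases cs.length_mul_simple v i with h | h <;> omega
    omega

theorem IsReducedRay.isGeodesicRay {cs : CoxeterSystem M G} {α : ℕ → G} (h : cs.IsReducedRay α) :
    cs.cayleyGraph.IsGeodesicRay α := by
  have hadj : ∀ n, cs.cayleyGraph.Adj (α n) (α (n + 1)) := by
    intro n
    obtain ⟨i, hi⟩ := h.step n
    refine (SimpleGraph.mulCayley_adj' _ _ _).2 ⟨?_, cs.simple i, ⟨i, rfl⟩, Or.inl hi.symm⟩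
    intro e
    have := congrArg cs.length e
    rw [h.length_eq, h.length_eq] at this
    omega
  refine ⟨hadj, fun i j hij => ?_⟩
  obtain ⟨k, rfl⟩ := Nat.exists_eq_add_of_le hij
  have hwalk : ∀ k, ∃ w : cs.cayleyGraph.Walk (α i) (α (i + k)), w.length = k := by
    intro k
    induction k with
    | zero => exact ⟨SimpleGraph.Walk.nil, rfl⟩
    | succ k ih =>
      obtain ⟨w, hw⟩ := ih
      exact ⟨w.concat (hadj (i + k)), by rw [SimpleGraph.Walk.length_concat, hw]⟩
  obtain ⟨w, hw⟩ := hwalk k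
  have h1 := SimpleGraph.dist_le w
  obtain ⟨w', hw'⟩ := w.reachable.exists_walk_length_eq_dist
  have h2 := cs.length_le_length_add_of_walk w'
  rw [h.length_eq, h.length_eq] at h2
  omega

/-- The ray `α` with its initial segment up to `α n` replaced by the path with labels `L`. -/
def splice (cs : CoxeterSystem M G) (L : List B) (α : ℕ → G) (n : ℕ) : G :=
  if n ≤ L.length then cs.wordProd (L.take n) else α n

theorem IsReducedRay.splice {cs : CoxeterSystem M G} {α : ℕ → G} (h : cs.IsReducedRay α)
    {L : List B} (hL : cs.wordProd L = α L.length) : cs.IsReducedRay (cs.splice L α) := by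
  have hred : cs.IsReduced L := by rw [IsReduced, hL, h.length_eq]
  refine ⟨fun n => ?_, fun n => ?_⟩
  · unfold CoxeterSystem.splice
    rcases lt_trichotomy n L.length with hn | rfl | hn
    · rw [if_pos hn.le, if_pos (Nat.succ_le_of_lt hn)]
      refine ⟨L[n], ?_⟩
      rw [List.take_succ_eq_append_getElem hn, wordProd_append, wordProd_singleton]
    · rw [if_pos le_rfl, if_neg (by omega), List.take_length, hL]
      exact h.step _
    · rw [if_neg (by omega), if_neg (by omega)]
      exact h.step n
  · unfold CoxeterSystem.splice
    split_ifs with hn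
    · rw [(hred.take n).eq, List.length_take, min_eq_left hn]
    · exact h.length_eq n

/-- Take `f n` to be the first time at which the length is `n`. The last clause says that `q` only
pauses between these times; it later bounds the jumps of the time parameter. -/
theorem exists_reindex_of_monotone_length (cs : CoxeterSystem M G) {q : ℕ → G} (h0 : q 0 = 1)
    (hq : ∀ l, q (l + 1) = q l ∨
      ∃ i, q (l + 1) = q l * cs.simple i ∧ cs.length (q (l + 1)) = cs.length (q l) + 1)
    (hunb : ∀ n, ∃ l, n ≤ cs.length (q l)) :
    ∃ f : ℕ → ℕ, cs.IsReducedRay (q ∘ f) ∧ StrictMono f ∧ f 0 = 0 ∧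
      ∀ n, q (f (n + 1) - 1) = q (f n) := by
  have hmono : ∀ a b, a ≤ b → cs.length (q a) ≤ cs.length (q b) ∧
      (cs.length (q a) = cs.length (q b) → q a = q b) := by
    intro a b hab
    induction b, hab using Nat.le_induction with
    | base => exact ⟨le_rfl, fun _ => rfl⟩
    | succ b hb ih =>
      rcases hq b with h | ⟨i, -, h⟩
      · rwa [h]
      · refine ⟨by omega, fun h2 => ?_⟩
        have := ih.1
        omega
  have hex : ∀ n, ∃ l, cs.length (q l) = n := by
    intro n
    have hfind := Nat.find_spec (hunb n)
    rcases Nat.eq_zero_or_pos (Nat.find (hunb n)) with h | h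
    · rw [h] at hfind
      refine ⟨0, ?_⟩
      rw [h0, length_one] at hfind ⊢
      omega
    · obtain ⟨l, hl⟩ := Nat.exists_eq_succ_of_ne_zero h.ne'
      have hlt := Nat.find_min (hunb n) (m := l) (by omega)
      rw [hl] at hfind
      refine ⟨l + 1, ?_⟩
      rcases hq l with h | ⟨i, -, h⟩
      · rw [Nat.succ_eq_add_one, h] at hfind; omega
      · rw [Nat.succ_eq_add_one] at hfind; omega
  let f : ℕ → ℕ := fun n => Nat.find (hex n)
  have hf : ∀ n, cs.length (q (f n)) = n := fun n => Nat.find_spec (hex n)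
  have hfmin : ∀ n l, cs.length (q l) = n → f n ≤ l := fun n l h => Nat.find_min' (hex n) h
  have hlt : ∀ n, f n < f (n + 1) := by
    intro n
    by_contra hcon
    have := (hmono _ _ (not_lt.1 hcon)).1
    rw [hf, hf] at this
    omega
  have hprev : ∀ n, q (f (n + 1) - 1) = q (f n) ∧ ∃ i, q (f (n + 1)) = q (f n) * cs.simple i := by
    intro n
    obtain ⟨l, hl⟩ := Nat.exists_eq_succ_of_ne_zero (Nat.ne_zero_of_lt (hlt n))
    have hln : f n ≤ l := by have := hlt n; omega
    have h1 := hf (n + 1)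
    rw [hl, Nat.succ_eq_add_one] at h1 ⊢
    rw [Nat.add_sub_cancel]
    rcases hq l with h | ⟨i, h, h2⟩
    · rw [h] at h1
      have := hfmin _ _ h1
      omega
    · have h3 : q (f n) = q l := (hmono _ _ hln).2 (by rw [hf]; omega)
      exact ⟨h3.symm, i, by rw [h, h3]⟩
  refine ⟨f, ⟨fun n => (hprev n).2, hf⟩, strictMono_nat_of_lt_succ hlt, ?_, fun n => (hprev n).1⟩
  exact Nat.le_zero.1 (hfmin 0 0 (by rw [h0, length_one]))

end CoxeterSystem

/-! ### Convexity of the metric of a CAT(0) space -/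

theorem exists_triangle {p q r : ℝ} (hp : 0 ≤ p) (hq : 0 ≤ q) (hr : 0 ≤ r) (h1 : p ≤ q + r)
    (h2 : q ≤ p + r) (h3 : r ≤ p + q) :
    ∃ a b c : EuclideanSpace ℝ (Fin 2), dist a b = p ∧ dist a c = q ∧ dist b c = r := by
  rcases hp.eq_or_lt with rfl | hp
  · obtain rfl : q = r := by linarith
    refine ⟨!₂[0, 0], !₂[0, 0], !₂[q, 0], ?_, ?_, ?_⟩ <;>
      simp [EuclideanSpace.dist_eq, Fin.sum_univ_two, Real.dist_eq, Real.sqrt_sq_eq_abs, abs_of_nonneg hq]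
  -- The third vertex has first coordinate `x` by the law of cosines; the triangle inequalities give
  -- `|x| ≤ q`.
  · set x := (p ^ 2 + q ^ 2 - r ^ 2) / (2 * p) with hx
    have hxp : 2 * p * x = p ^ 2 + q ^ 2 - r ^ 2 := by rw [hx]; field_simp
    have hy : 0 ≤ q ^ 2 - x ^ 2 := by
      have a1 : 2 * p * x ≤ 2 * p * q := by nlinarith
      have a2 : -(2 * p * q) ≤ 2 * p * x := by nlinarith
      have b1 : x ≤ q := le_of_mul_le_mul_left a1 (by positivity)
      have b2 : -q ≤ x := le_of_mul_le_mul_left (by linarith) (show 0 < 2 * p by positivity)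
      nlinarith
    refine ⟨!₂[0, 0], !₂[p, 0], !₂[x, √(q ^ 2 - x ^ 2)], ?_, ?_, ?_⟩
    · simp [EuclideanSpace.dist_eq, Fin.sum_univ_two, Real.dist_eq, Real.sqrt_sq_eq_abs,
        abs_of_nonneg hp.le]
    · simp only [EuclideanSpace.dist_eq, Fin.sum_univ_two, Real.dist_eq, sq_abs]
      simp [Real.sq_sqrt hy, Real.sqrt_sq hq]
    · simp only [EuclideanSpace.dist_eq, Fin.sum_univ_two, Real.dist_eq, sq_abs]
      simp only [Matrix.cons_val_zero, Matrix.cons_val_one, zero_sub, neg_sq,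
        Real.sq_sqrt hy]
      rw [show (p - x) ^ 2 + (q ^ 2 - x ^ 2) = r ^ 2 by linarith, Real.sqrt_sq hr]

section CAT0

variable {X : Type*} [MetricSpace X]

theorem IsGeodesic.dist_endpoints {c : ℝ → X} {D : ℝ} {x y : X} (h : IsGeodesic c D x y) :
    dist x y = D := by
  have := h.dist_eq 0 ⟨le_rfl, h.nonneg⟩ D ⟨h.nonneg, le_rfl⟩
  rwa [h.source, h.target, zero_sub, abs_neg, abs_of_nonneg h.nonneg] at this

theorem IsGeodesic.reverse {c : ℝ → X} {D : ℝ} {x y : X} (h : IsGeodesic c D x y) :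
    IsGeodesic (fun t => c (D - t)) D y x where
  nonneg := h.nonneg
  source := by simpa using h.target
  target := by simpa using h.source
  dist_eq t ht t' ht' := by
    rw [h.dist_eq _ ⟨by linarith [ht.2], by linarith [ht.1]⟩ _
      ⟨by linarith [ht'.2], by linarith [ht'.1]⟩, abs_sub_comm]
    congr 1
    ring

theorem IsCAT0.dist_le_mul_of_common_source (hX : IsCAT0 X) {f g : ℝ → X} {D E : ℝ} {a b c : X}
    (hf : IsGeodesic f D a b) (hg : IsGeodesic g E a c) {l : ℝ} (hl : l ∈ Set.Icc (0 : ℝ) 1) :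
    dist (f (l * D)) (g (l * E)) ≤ l * dist b c := by
  obtain rfl := hf.dist_endpoints
  obtain rfl := hg.dist_endpoints
  obtain ⟨a', b', c', h1, h2, h3⟩ := exists_triangle (dist_nonneg (x := a) (y := b))
    (dist_nonneg (x := a) (y := c)) (dist_nonneg (x := b) (y := c))
    (by rw [dist_comm b c]; exact dist_triangle _ _ _) (dist_triangle _ _ _)
    (by rw [dist_comm a b]; exact dist_triangle _ _ _)
  have hmem : ∀ d : ℝ, 0 ≤ d → l * d ∈ Set.Icc 0 d := fun d hd =>
    ⟨mul_nonneg hl.1 hd, mul_le_of_le_one_left hd hl.2⟩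
  have key := hX.comparison a b c f g hf hg a' b' c' h1 h2 h3 _ (hmem _ dist_nonneg) _
    (hmem _ dist_nonneg) (AffineMap.lineMap a' b' l) (AffineMap.lineMap a' c' l)
    (by rw [dist_left_lineMap, Real.norm_of_nonneg hl.1, h1])
    (by rw [dist_lineMap_right, Real.norm_of_nonneg (by linarith [hl.2]), h1]; ring)
    (by rw [dist_left_lineMap, Real.norm_of_nonneg hl.1, h2])
    (by rw [dist_lineMap_right, Real.norm_of_nonneg (by linarith [hl.2]), h2]; ring)
  refine key.trans (le_of_eq ?_)
  rw [← h3]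
  simp only [AffineMap.lineMap_apply, vsub_eq_sub, vadd_eq_add, dist_add_right]
  rw [dist_eq_norm, ← smul_sub, norm_smul, Real.norm_of_nonneg hl.1, dist_eq_norm]
  congr 2
  abel

/-- A diagonal cuts the quadrilateral into two triangles. The bounds from the two common vertices
add up to a convex combination of the end distances. -/
theorem IsCAT0.dist_le_max (hX : IsCAT0 X) {c c' : ℝ → X} {D : ℝ} {x y x' y' : X}
    (hc : IsGeodesic c D x y) (hc' : IsGeodesic c' D x' y') {t : ℝ} (ht : t ∈ Set.Icc 0 D) :
    dist (c t) (c' t) ≤ max (dist x x') (dist y y') := by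
  rcases hc.nonneg.eq_or_lt with rfl | hD
  · obtain rfl : t = 0 := le_antisymm ht.2 ht.1
    rw [hc.source, hc'.source]
    exact le_max_left _ _
  obtain ⟨E, g, hg⟩ := hX.geodesic x y'
  set l := t / D with hl
  have hl01 : l ∈ Set.Icc (0 : ℝ) 1 := ⟨div_nonneg ht.1 hD.le, div_le_one_of_le₀ ht.2 hD.le⟩
  have hlD : l * D = t := by rw [hl]; field_simp
  have h1 := hX.dist_le_mul_of_common_source hc hg hl01
  have h2 := hX.dist_le_mul_of_common_source hg.reverse hc'.reverse (l := 1 - l)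
    ⟨by linarith [hl01.2], by linarith [hl01.1]⟩
  simp only [sub_mul, one_mul, sub_sub_cancel, hlD] at h1 h2
  have h3 := dist_triangle (c t) (g (l * E)) (c' t)
  have h4 := le_max_left (dist x x') (dist y y')
  have h5 := le_max_right (dist x x') (dist y y')
  have h6 := mul_le_mul_of_nonneg_left h5 hl01.1
  have h7 := mul_le_mul_of_nonneg_left h4 (sub_nonneg.2 hl01.2)
  linarith

theorem isGeodesic_of_isometry {r : NNReal → X} (hr : Isometry r) {a b : NNReal} (hab : a ≤ b) :
    IsGeodesic (fun t => r (a + t.toNNReal)) (b - a) (r a) (r b) where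
  nonneg := sub_nonneg.2 (by exact_mod_cast hab)
  source := by simp
  target := by
    congr 1
    ext
    rw [NNReal.coe_add, Real.coe_toNNReal _ (sub_nonneg.2 (by exact_mod_cast hab))]
    ring
  dist_eq t ht t' ht' := by
    rw [hr.dist_eq, NNReal.dist_eq, NNReal.coe_add, NNReal.coe_add, Real.coe_toNNReal _ ht.1,
      Real.coe_toNNReal _ ht'.1]
    congr 1
    ring

theorem IsCAT0.dist_rays_le_max (hX : IsCAT0 X) {r s : NNReal → X} (hr : Isometry r)
    (hs : Isometry s) {a t b : NNReal} (hat : a ≤ t) (htb : t ≤ b) :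
    dist (r t) (s t) ≤ max (dist (r a) (s a)) (dist (r b) (s b)) := by
  have h1 : (a : ℝ) ≤ t := by exact_mod_cast hat
  have h2 : (t : ℝ) ≤ b := by exact_mod_cast htb
  have := hX.dist_le_max (isGeodesic_of_isometry hr (hat.trans htb))
    (isGeodesic_of_isometry hs (hat.trans htb)) (t := t - a) ⟨by linarith, by linarith⟩
  have e : a + ((t : ℝ) - a).toNNReal = t := by
    ext
    rw [NNReal.coe_add, Real.coe_toNNReal _ (by linarith)]
    ring
  rwa [e] at this

end CAT0

/-! ### Geometric actions of Coxeter groups -/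

section Geometric

variable {G X : Type*} [Group G] [MetricSpace X] [MulAction G X]

theorem IsGeometricAction.dist_smul (hG : IsGeometricAction G X) (g : G) (x y : X) :
    dist (g • x) (g • y) = dist x y :=
  (hG.isometric g).dist_eq x y

theorem IsGeometricAction.dist_orbit (hG : IsGeometricAction G X) (x₀ : X) (g h : G) :
    dist (g • x₀) (h • x₀) = dist x₀ ((g⁻¹ * h) • x₀) := by
  rw [← hG.dist_smul g x₀, smul_smul, mul_inv_cancel_left]

theorem IsGeometricAction.finite_ball (hG : IsGeometricAction G X) (hX : IsCAT0 X) (x₀ : X)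
    (R : ℝ) : {g : G | dist x₀ (g • x₀) ≤ R}.Finite := by
  have := hX.proper
  refine (hG.proper.finite_disjoint_inter_image (K := {x₀}) (L := Metric.closedBall x₀ R)
    isCompact_singleton (isCompact_closedBall x₀ R)).subset ?_
  intro g hg
  have hmem : g • x₀ ∈ (g • ·) '' {x₀} ∩ Metric.closedBall x₀ R :=
    ⟨⟨x₀, rfl, rfl⟩, by rw [Metric.mem_closedBall, dist_comm]; exact hg⟩
  exact Set.nonempty_of_mem hmem

theorem IsGeometricAction.exists_coarsely_dense (hG : IsGeometricAction G X) (x₀ : X) :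
    ∃ ρ : ℝ, ∀ x : X, ∃ g : G, dist (g • x₀) x ≤ ρ := by
  obtain ⟨K, hK, hcov⟩ := hG.cocompact
  obtain ⟨ρ, hρ⟩ := hK.isBounded.subset_closedBall x₀
  refine ⟨ρ, fun x => ?_⟩
  obtain ⟨g, y, hy, rfl⟩ := hcov x
  refine ⟨g, ?_⟩
  rw [hG.dist_smul, dist_comm]
  exact hρ hy

theorem IsGeometricAction.exists_length_bound (hG : IsGeometricAction G X) (hX : IsCAT0 X)
    {B : Type*} {M : CoxeterMatrix B} (cs : CoxeterSystem M G) (x₀ : X) (R : ℝ) :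
    ∃ K : ℕ, ∀ g : G, dist x₀ (g • x₀) ≤ R → cs.length g ≤ K := by
  obtain ⟨K, hK⟩ := ((hG.finite_ball hX x₀ R).image cs.length).bddAbove
  exact ⟨K, fun g hg => hK ⟨g, hg, rfl⟩⟩

theorem IsGeometricAction.exists_dist_simple_le {B : Type*} [Finite B] {M : CoxeterMatrix B}
    (cs : CoxeterSystem M G) (x₀ : X) :
    ∃ E : ℝ, 0 < E ∧ ∀ i, dist x₀ (cs.simple i • x₀) ≤ E := by
  obtain ⟨E, hE⟩ := (Set.finite_range fun i => dist x₀ (cs.simple i • x₀)).bddAbove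
  exact ⟨max E 1, by positivity, fun i => (hE ⟨i, rfl⟩).trans (le_max_left _ _)⟩

theorem IsGeometricAction.dist_le_mul_length (hG : IsGeometricAction G X)
    {B : Type*} {M : CoxeterMatrix B} (cs : CoxeterSystem M G) {x₀ : X} {E : ℝ}
    (hE : ∀ i, dist x₀ (cs.simple i • x₀) ≤ E) (g : G) :
    dist x₀ (g • x₀) ≤ E * cs.length g := by
  obtain ⟨ω, hω, rfl⟩ := cs.exists_isReduced g
  rw [hω.eq]
  clear hω
  induction ω with
  | nil => simp
  | cons i ω ih =>
    rw [cs.wordProd_cons, mul_smul, List.length_cons]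
    have h1 := dist_triangle x₀ (cs.simple i • x₀) (cs.simple i • cs.wordProd ω • x₀)
    rw [hG.dist_smul] at h1
    have h2 := hE i
    push_cast
    linarith

/-- The Švarc–Milnor argument: go along a geodesic in unit steps, with an orbit point near each;
consecutive orbit points differ by a word of bounded length. -/
theorem IsGeometricAction.exists_linear_length_bound (hG : IsGeometricAction G X) (hX : IsCAT0 X)
    {B : Type*} {M : CoxeterMatrix B} (cs : CoxeterSystem M G) (x₀ : X) :
    ∃ C : ℝ, 0 < C ∧ ∀ g : G, (cs.length g : ℝ) ≤ C * dist x₀ (g • x₀) + C := by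
  obtain ⟨ρ, hρ⟩ := hG.exists_coarsely_dense x₀
  obtain ⟨K, hK⟩ := hG.exists_length_bound hX cs x₀ (2 * ρ + 1)
  have hρ0 : 0 ≤ ρ := by
    obtain ⟨g, hg⟩ := hρ x₀
    exact dist_nonneg.trans hg
  have main : ∀ n : ℕ, ∀ y : X, dist x₀ y ≤ n →
      ∃ h : G, dist (h • x₀) y ≤ ρ ∧ cs.length h ≤ K * n := by
    intro n
    induction n with
    | zero =>
      intro y hy
      refine ⟨1, ?_, by simp⟩
      rw [one_smul]
      exact (by simpa using hy : dist x₀ y ≤ 0).trans hρ0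
    | succ n ih =>
      intro y hy
      obtain ⟨D, c, hc⟩ := hX.geodesic x₀ y
      rw [hc.dist_endpoints] at hy
      push_cast at hy
      have hc0 := hc.nonneg
      obtain ⟨y', h1, h2⟩ : ∃ y', dist x₀ y' ≤ n ∧ dist y' y ≤ 1 := by
        refine ⟨c (max 0 (D - 1)), ?_, ?_⟩
        · rw [← hc.source, hc.dist_eq 0 ⟨le_rfl, hc0⟩ _ ⟨le_max_left _ _, max_le hc0 (by linarith)⟩,
            zero_sub, abs_neg, abs_of_nonneg (le_max_left _ _)]
          exact max_le (Nat.cast_nonneg n) (by linarith)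
        · nth_rewrite 1 [← hc.target]
          rw [hc.dist_eq _ ⟨le_max_left _ _, max_le hc0 (by linarith)⟩ D ⟨hc0, le_rfl⟩, abs_le]
          constructor
          · linarith [le_max_right 0 (D - 1)]
          · linarith [max_le hc0 (show D - 1 ≤ D by linarith)]
      obtain ⟨h', h3, h4⟩ := ih y' h1
      obtain ⟨h, h5⟩ := hρ y
      refine ⟨h, h5, ?_⟩
      have h6 : cs.length (h'⁻¹ * h) ≤ K := by
        refine hK _ ?_
        rw [← hG.dist_orbit]
        have := dist_triangle4 (h' • x₀) y' y (h • x₀)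
        rw [dist_comm y] at this
        linarith
      have h7 := cs.length_mul_le h' (h'⁻¹ * h)
      rw [mul_inv_cancel_left] at h7
      rw [mul_add, mul_one]
      omega
  refine ⟨2 * K + 1, by positivity, fun g => ?_⟩
  obtain ⟨h, h1, h2⟩ := main ⌈dist x₀ (g • x₀)⌉₊ (g • x₀) (Nat.le_ceil _)
  have h3 : cs.length (h⁻¹ * g) ≤ K := by
    refine hK _ ?_
    rw [← hG.dist_orbit]
    linarith
  have h4 := cs.length_mul_le h (h⁻¹ * g)
  rw [mul_inv_cancel_left] at h4
  have h5 : (cs.length g : ℝ) ≤ K * ⌈dist x₀ (g • x₀)⌉₊ + K := by exact_mod_cast by omega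
  have h6 := (Nat.ceil_lt_add_one (dist_nonneg (x := x₀) (y := g • x₀))).le
  have h7 : (K : ℝ) * ⌈dist x₀ (g • x₀)⌉₊ ≤ K * (dist x₀ (g • x₀) + 1) :=
    mul_le_mul_of_nonneg_left h6 (Nat.cast_nonneg K)
  have h8 : 0 ≤ dist x₀ (g • x₀) := dist_nonneg
  have h9 : 0 ≤ (K : ℝ) * dist x₀ (g • x₀) := by positivity
  linarith

/-! ### Tracking rays -/

theorem IsGeometricAction.exists_lazyPath (hG : IsGeometricAction G X) (hX : IsCAT0 X)
    {B : Type*} [Finite B] {M : CoxeterMatrix B} (cs : CoxeterSystem M G) (x₀ : X) :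
    ∃ (K : ℕ) (δ : ℝ), 0 < K ∧ ∀ r : NNReal → X, Isometry r → r 0 = x₀ →
      ∃ p : ℕ → G, cs.IsLazyPath p ∧ ∀ l, dist (p l • x₀) (r (l / K : ℕ)) ≤ δ := by
  obtain ⟨E, hE0, hE⟩ := IsGeometricAction.exists_dist_simple_le cs x₀
  obtain ⟨ρ, hρ⟩ := hG.exists_coarsely_dense x₀
  have hρ0 : 0 ≤ ρ := by
    obtain ⟨g, hg⟩ := hρ x₀
    exact dist_nonneg.trans hg
  obtain ⟨K, hK⟩ := hG.exists_length_bound hX cs x₀ (2 * ρ + 1)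
  -- Each unit of time gets `K + 1` slots: a word of length at most `K` is spelled out, then padded
  -- with pauses, so the last slot is always a pause.
  refine ⟨K + 1, ρ + E * (K + 1), K.succ_pos, fun r hr hr0 => ?_⟩
  obtain ⟨g, hg0, hg⟩ : ∃ g : ℕ → G, g 0 = 1 ∧ ∀ n, dist (g n • x₀) (r (n : ℕ)) ≤ ρ := by
    choose k hk using hρ
    refine ⟨fun n => if n = 0 then 1 else k (r (n : ℕ)), if_pos rfl, fun n => ?_⟩
    by_cases hn : n = 0
    · subst hn
      simpa [hr0] using hρ0
    · simp only [if_neg hn]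
      exact hk _
  have hlen : ∀ n, cs.length ((g n)⁻¹ * g (n + 1)) ≤ K := by
    intro n
    refine hK _ ?_
    rw [← hG.dist_orbit]
    have h1 := dist_triangle4 (g n • x₀) (r (n : ℕ)) (r (n + 1 : ℕ)) (g (n + 1) • x₀)
    have h2 := hg n
    have h3 := hg (n + 1)
    rw [dist_comm] at h3
    have h4 : dist (r (n : ℕ)) (r (n + 1 : ℕ)) = 1 := by
      rw [hr.dist_eq, NNReal.dist_eq]
      push_cast
      rw [abs_sub_comm]
      simp
    linarith
  choose w hw hwe using fun n => cs.exists_isReduced ((g n)⁻¹ * g (n + 1))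
  have hwl : ∀ n, (w n).length ≤ K := fun n => by rw [← (hw n).eq, ← hwe]; exact hlen n
  have hstep : ∀ n j, g n * cs.wordProd ((w n).take (j + 1)) = g n * cs.wordProd ((w n).take j) ∨
      ∃ i, g n * cs.wordProd ((w n).take (j + 1)) =
        g n * cs.wordProd ((w n).take j) * cs.simple i := by
    intro n j
    by_cases hj : j < (w n).length
    · refine Or.inr ⟨(w n)[j], ?_⟩
      rw [List.take_succ_eq_append_getElem hj, cs.wordProd_append, cs.wordProd_singleton, mul_assoc]
    · left
      rw [List.take_of_length_le (by omega), List.take_of_length_le (by omega)]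
  refine ⟨fun l => g (l / (K + 1)) * cs.wordProd ((w (l / (K + 1))).take (l % (K + 1))),
    ⟨by simp [hg0], fun l => ?_⟩, fun l => ?_⟩
  · by_cases hl : l % (K + 1) = K
    · have e1 : (l + 1) / (K + 1) = l / (K + 1) + 1 := by
        rw [Nat.succ_div, if_pos]
        rw [Nat.dvd_iff_mod_eq_zero, Nat.add_mod, hl]
        rcases K with _ | K <;> simp
      have e2 : (l + 1) % (K + 1) = 0 := by
        rw [Nat.add_mod, hl]
        rcases K with _ | K <;> simp
      left
      simp only [e1, e2, hl, List.take_zero, cs.wordProd_nil, mul_one]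
      rw [List.take_of_length_le (hwl _), ← hwe, mul_inv_cancel_left]
    · have hlt : l % (K + 1) < K := by
        have : l % (K + 1) < K + 1 := Nat.mod_lt l K.succ_pos
        omega
      have e0 := Nat.div_add_mod l (K + 1)
      have e1 : (l + 1) / (K + 1) = l / (K + 1) := by
        rw [Nat.div_eq_iff (by omega)]
        constructor
        · rw [mul_comm]; omega
        · rw [mul_comm]; omega
      have e2 : (l + 1) % (K + 1) = l % (K + 1) + 1 := by
        have := Nat.div_add_mod (l + 1) (K + 1)
        rw [e1] at this
        omega
      simp only [e1, e2]
      exact hstep _ _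
  · set n := l / (K + 1)
    have h1 := dist_triangle ((g n * cs.wordProd ((w n).take (l % (K + 1)))) • x₀) (g n • x₀)
      (r (n : ℕ))
    have h2 := hg n
    have h3 : dist ((g n * cs.wordProd ((w n).take (l % (K + 1)))) • x₀) (g n • x₀) ≤
        E * (K + 1) := by
      rw [dist_comm, hG.dist_orbit, inv_mul_cancel_left]
      refine (hG.dist_le_mul_length cs hE _).trans (mul_le_mul_of_nonneg_left ?_ hE0.le)
      have h4 := cs.length_wordProd_le ((w n).take (l % (K + 1)))
      rw [List.length_take] at h4
      have h5 := hwl n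
      exact_mod_cast (by omega : cs.length (cs.wordProd ((w n).take (l % (K + 1)))) ≤ K + 1)
    linarith

/-- The displacement of an isometry along a ray is quasi-convex. -/
theorem IsGeometricAction.displacement_le (hG : IsGeometricAction G X) (hX : IsCAT0 X)
    {r : NNReal → X} (hr : Isometry r) (g : G) {a t b : NNReal} (hat : a ≤ t) (htb : t ≤ b) {C : ℝ}
    (ha : dist (r a) (g • r a) ≤ C) (hb : dist (r b) (g • r b) ≤ C) :
    dist (r t) (g • r t) ≤ C :=
  (hX.dist_rays_le_max hr ((hG.isometric g).comp hr) hat htb).trans (max_le ha hb)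

theorem IsGeometricAction.displacement_le_of_dist_le (hG : IsGeometricAction G X) {x y : X} {δ C : ℝ}
    (hxy : dist x y ≤ δ) {g : G} (hx : dist x (g • x) ≤ C) : dist y (g • y) ≤ C + 2 * δ := by
  have h1 := dist_triangle4 y x (g • x) (g • y)
  rw [hG.dist_smul, dist_comm y x] at h1
  linarith

theorem IsGeometricAction.exists_trackingRay (hG : IsGeometricAction G X) (hX : IsCAT0 X)
    {B : Type*} [Finite B] {M : CoxeterMatrix B} (hM : M.IsRightAngled) (cs : CoxeterSystem M G)
    (x₀ : X) :
    ∃ δ : NNReal, ∀ r : NNReal → X, Isometry r → r 0 = x₀ →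
      ∃ (α : ℕ → G) (τ : ℕ → NNReal), cs.IsReducedRay α ∧ Monotone τ ∧ τ 0 = 0 ∧
        (∀ n, dist (α n • x₀) (r (τ n)) ≤ δ) ∧ (∀ n, τ (n + 1) ≤ τ n + δ) ∧
        ∀ T, ∃ n, T < τ n := by
  obtain ⟨E, hE0, hE⟩ := IsGeometricAction.exists_dist_simple_le cs x₀
  obtain ⟨K, δ₁, hK, hpath⟩ := hG.exists_lazyPath hX cs x₀
  -- A reflection moves the midpath vertex whose edge it flips by at most `E`. Passing from `p` to
  -- `r` at the crossings costs `2 * δ₁`, and passing back to `p l` costs `2 * δ₁` again.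
  have hfin := hG.finite_ball hX x₀ (E + 2 * δ₁ + 2 * δ₁)
  set N := {g : G | dist x₀ (g • x₀) ≤ E + 2 * δ₁ + 2 * δ₁}.ncard with hN
  set δ₂ : ℝ := δ₁ + E * N with hδ₂
  -- The jump bound: just before `f (n + 1)` the path `q` is still at `q (f n)`, so the two points
  -- of `r` differ by at most `2 * δ₂`, and one more slot adds at most `1`.
  refine ⟨(2 * δ₂ + 1).toNNReal, fun r hr hr0 => ?_⟩
  obtain ⟨p, hp, hpr⟩ := hpath r hr hr0
  have hδ₁ : 0 ≤ δ₁ := dist_nonneg.trans (hpr 0)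
  have hδ₂0 : 0 ≤ δ₂ := by positivity
  obtain ⟨q, hq0, hq, hpq⟩ := hp.exists_straightening hM
  have htime : ∀ {a b : ℕ}, a ≤ b → ((a / K : ℕ) : NNReal) ≤ ((b / K : ℕ) : NNReal) :=
    fun h => by exact_mod_cast Nat.div_le_div_right h
  have hclose : ∀ l, dist (q l • x₀) (r (l / K : ℕ)) ≤ δ₂ := by
    intro l
    have h1 : cs.length ((p l)⁻¹ * q l) ≤ N := by
      refine cs.length_le_ncard_of_isLeftInversion hM _ hfin ?_
      intro u hu
      obtain ⟨m, n, i, j, hml, hln, hm, hn⟩ := hpq l u hu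
      set t := p l * u * (p l)⁻¹ with ht
      have hcross : ∀ m i, t = p m * cs.simple i * (p m)⁻¹ →
          dist (r (m / K : ℕ)) (t • r (m / K : ℕ)) ≤ E + 2 * δ₁ := by
        intro m i hm
        refine hG.displacement_le_of_dist_le (hpr m) ?_
        rw [smul_smul, hG.dist_orbit, hm]
        simpa [mul_assoc] using hE i
      have h2 := hG.displacement_le hX hr t (htime hml) (htime hln) (hcross m i hm) (hcross n j hn)
      have h3 := hG.displacement_le_of_dist_le ((dist_comm _ _).trans_le (hpr l)) h2
      rw [smul_smul, hG.dist_orbit, ht] at h3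
      simpa [mul_assoc] using h3
    have h2 : dist (q l • x₀) (p l • x₀) ≤ E * N := by
      rw [dist_comm, hG.dist_orbit]
      refine (hG.dist_le_mul_length cs hE _).trans (mul_le_mul_of_nonneg_left ?_ hE0.le)
      exact_mod_cast h1
    have h3 := dist_triangle (q l • x₀) (p l • x₀) (r (l / K : ℕ))
    have h4 := hpr l
    linarith
  have hr_dist : ∀ t, dist x₀ (r t) = t := by
    intro t
    rw [← hr0, hr.dist_eq, NNReal.dist_eq]
    simp
  have hunb : ∀ n, ∃ l, n ≤ cs.length (q l) := by
    intro n
    obtain ⟨m, hm⟩ := exists_nat_ge (E * n + δ₂)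
    refine ⟨m * K, ?_⟩
    have h1 := hclose (m * K)
    rw [Nat.mul_div_cancel _ hK] at h1
    have h2 := dist_triangle x₀ (q (m * K) • x₀) (r m)
    rw [hr_dist] at h2
    have h3 := hG.dist_le_mul_length cs hE (q (m * K))
    have h4 : E * n ≤ E * cs.length (q (m * K)) := by
      rw [NNReal.coe_natCast] at h2
      linarith
    exact_mod_cast le_of_mul_le_mul_left h4 hE0
  obtain ⟨f, hf, hfm, hf0, hfq⟩ := cs.exists_reindex_of_monotone_length hq0 hq hunb
  have hcoe : ((2 * δ₂ + 1).toNNReal : ℝ) = 2 * δ₂ + 1 := Real.coe_toNNReal _ (by positivity)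
  refine ⟨q ∘ f, fun n => ((f n / K : ℕ) : NNReal), hf, fun a b hab => htime (hfm.monotone hab),
    by simp [hf0], fun n => ?_, fun n => ?_, fun T => ?_⟩
  · rw [hcoe]
    have := hclose (f n)
    rw [Function.comp_apply]
    linarith
  · rw [← NNReal.coe_le_coe, NNReal.coe_add, hcoe]
    have hlt := hfm n.lt_succ_self
    obtain ⟨b, hb⟩ := Nat.exists_eq_succ_of_ne_zero (Nat.ne_zero_of_lt hlt)
    have h1 := hfq n
    rw [hb, Nat.succ_sub_one] at h1
    have h2 := hclose b
    have h3 := hclose (f n)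
    rw [h1] at h2
    have h4 := dist_triangle_left (r (b / K : ℕ)) (r (f n / K : ℕ)) (q (f n) • x₀)
    rw [hr.dist_eq, NNReal.dist_eq] at h4
    have h5 := le_abs_self (((b / K : ℕ) : NNReal) - ((f n / K : ℕ) : NNReal) : ℝ)
    have h6 : (b + 1) / K ≤ b / K + 1 := by
      rw [Nat.succ_div]
      split_ifs <;> omega
    have h7 : (((b + 1) / K : ℕ) : ℝ) ≤ ((b / K : ℕ) : ℝ) + 1 := by exact_mod_cast h6
    simp only [NNReal.coe_natCast] at h4 h5 ⊢
    rw [hb]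
    linarith
  · obtain ⟨m, hm⟩ := exists_nat_gt T
    refine ⟨m * K, hm.trans_le ?_⟩
    have h1 := Nat.div_le_div_right (c := K) (hfm.id_le (m * K))
    rw [id, Nat.mul_div_cancel _ hK] at h1
    change (m : NNReal) ≤ ((f (m * K) / K : ℕ) : NNReal)
    exact_mod_cast h1

end Geometric

/-! ### Rays with a common initial segment -/

section Splicing

variable {G : Type*} [Group G] {B : Type*} {M : CoxeterMatrix B} {cs : CoxeterSystem M G}

theorem CoxeterSystem.IsReducedRay.exists_word {α : ℕ → G} (h : cs.IsReducedRay α) (n : ℕ) :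
    ∃ ω : List B, ω.length = n ∧ ∀ k, cs.wordProd (ω.take k) = α (min k n) := by
  induction n with
  | zero => exact ⟨[], rfl, fun k => by simp [h.zero]⟩
  | succ n ih =>
    obtain ⟨ω, hω, hk⟩ := ih
    obtain ⟨i, hi⟩ := h.step n
    refine ⟨ω ++ [i], by simp [hω], fun k => ?_⟩
    rcases Nat.lt_or_ge n k with hnk | hnk
    · rw [List.take_of_length_le (by simp [hω]; omega), cs.wordProd_append, cs.wordProd_singleton,
        min_eq_right (by omega), hi]
      have := hk n
      rw [← hω, List.take_length, hω, min_self] at this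
      rw [this]
    · rw [List.take_append_of_le_length (by omega), hk, min_eq_left hnk, min_eq_left (by omega)]

/-- A ray can be rerouted through any element `wordProd ω` between `1` and `α n`. -/
theorem CoxeterSystem.IsReducedRay.exists_reroute {α : ℕ → G} (h : cs.IsReducedRay α) {n : ℕ}
    {ω : List B} (hω : cs.length (α n) = ω.length + cs.length ((cs.wordProd ω)⁻¹ * α n)) :
    ∃ γ : ℕ → G, cs.IsReducedRay γ ∧ (∀ i ≤ ω.length, γ i = cs.wordProd (ω.take i)) ∧
      ∀ i, (∃ k, γ i = cs.wordProd (ω.take k)) ∨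
        (∃ e, γ i = α n * e ∧ cs.length e ≤ cs.length ((cs.wordProd ω)⁻¹ * α n)) ∨
        ∃ k, γ i = α k := by
  obtain ⟨ρ, hρ, hρe⟩ := cs.exists_isReduced ((cs.wordProd ω)⁻¹ * α n)
  have hprod : cs.wordProd (ω ++ ρ) = α n := by
    rw [cs.wordProd_append, ← hρe, mul_inv_cancel_left]
  have hlen : (ω ++ ρ).length = n := by
    rw [hρe, hρ.eq, h.length_eq] at hω
    rw [List.length_append, hω]
  have hinit : ∀ i ≤ ω.length, cs.splice (ω ++ ρ) α i = cs.wordProd (ω.take i) := by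
    intro i hi
    unfold CoxeterSystem.splice
    rw [if_pos (by rw [List.length_append]; omega), List.take_append_of_le_length hi]
  refine ⟨cs.splice (ω ++ ρ) α, h.splice (by rw [hprod, hlen]), hinit, fun i => ?_⟩
  by_cases hi : i ≤ ω.length
  · exact Or.inl ⟨i, hinit i hi⟩
  right
  unfold CoxeterSystem.splice
  split_ifs with hi2
  · left
    refine ⟨(cs.wordProd ((ω ++ ρ).drop i))⁻¹, ?_, ?_⟩
    · rw [← hprod, eq_mul_inv_iff_mul_eq, ← cs.wordProd_append, List.take_append_drop]
    · rw [cs.length_inv, hρe, hρ.eq]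
      refine (cs.length_wordProd_le _).trans ?_
      rw [List.length_drop, List.length_append]
      omega
  · exact Or.inr ⟨i, rfl⟩

variable {X : Type*} [MetricSpace X] [MulAction G X]

theorem IsGeometricAction.tracks_of_vertices (hG : IsGeometricAction G X) {x₀ : X} {E η : ℝ}
    (hE : ∀ i, dist x₀ (cs.simple i • x₀) ≤ E) (hEη : 0 ≤ E + η) {γ : ℕ → G}
    (hγ : cs.IsReducedRay γ) {s : NNReal → X} (hs : s 0 = x₀)
    (h : ∀ n, ∃ t, dist (γ n • x₀) (s t) ≤ η) : Tracks x₀ (E + η) γ s := by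
  refine ⟨?_, by rw [hγ.zero, one_smul, hs, dist_self]; exact hEη⟩
  rintro p ⟨n, D, c, hc, t, ht, rfl⟩
  obtain ⟨t', ht'⟩ := h n
  refine ⟨t', ?_⟩
  have h1 := dist_triangle (c t) (γ n • x₀) (s t')
  have h2 : dist (c t) (γ n • x₀) ≤ D := by
    rw [← hc.source, hc.dist_eq t ht 0 ⟨le_rfl, hc.nonneg⟩, sub_zero, abs_of_nonneg ht.1]
    exact ht.2
  have h3 : D ≤ E := by
    obtain ⟨i, hi⟩ := hγ.step n
    rw [← hc.dist_endpoints, hi, hG.dist_orbit, inv_mul_cancel_left]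
    exact hE i
  linarith

theorem IsGeometricAction.dist_mul_le (hG : IsGeometricAction G X) {x₀ : X} {E K : ℝ}
    (hE0 : 0 ≤ E) (hE : ∀ i, dist x₀ (cs.simple i • x₀) ≤ E) (g : G) {e : G}
    (he : (cs.length e : ℝ) ≤ K) : dist ((g * e) • x₀) (g • x₀) ≤ E * K := by
  rw [dist_comm, hG.dist_orbit, inv_mul_cancel_left]
  exact (hG.dist_le_mul_length cs hE e).trans (mul_le_mul_of_nonneg_left he hE0)

theorem exists_time_le_dist_le {x₀ : X} {δ : NNReal} {r : NNReal → X} (hr : Isometry r)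
    {α : ℕ → G} {τ : ℕ → NNReal} (hτ0 : τ 0 = 0)
    (hα : ∀ n, dist (α n • x₀) (r (τ n)) ≤ δ) (hτ : ∀ n, τ (n + 1) ≤ τ n + δ)
    (hunb : ∀ T, ∃ n, T < τ n) (R : NNReal) :
    ∃ n, τ n ≤ R ∧ dist (α n • x₀) (r R) ≤ 2 * δ := by
  have h1 := Nat.find_spec (hunb R)
  have h0 : Nat.find (hunb R) ≠ 0 := by
    intro h
    rw [h, hτ0] at h1
    exact not_lt_zero h1
  obtain ⟨n, hn⟩ := Nat.exists_eq_succ_of_ne_zero h0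
  -- This is the vertex just before the time first exceeds `R`, so its time is within `δ` of `R`.
  have h2 : τ n ≤ R := not_lt.1 (Nat.find_min (hunb R) (m := n) (by omega))
  rw [hn] at h1
  refine ⟨n, h2, ?_⟩
  have h3 := dist_triangle (α n • x₀) (r (τ n)) (r R)
  rw [hr.dist_eq, NNReal.dist_eq, abs_sub_comm,
    abs_of_nonneg (sub_nonneg.2 (NNReal.coe_le_coe.2 h2))] at h3
  have h4 : (R : ℝ) ≤ τ n + δ := by exact_mod_cast (h1.trans_le (hτ n)).le
  have h5 := hα n
  linarith

end Splicing

/-! ### Merging the two tracking rays. -/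

theorem lemma4p3 {B : Type*} [Finite B] {M : CoxeterMatrix B} (hM : M.IsRightAngled)
    {G : Type*} [Group G] (cs : CoxeterSystem M G)
    {X : Type*} [MetricSpace X] (hX : IsCAT0 X) [MulAction G X] (hG : IsGeometricAction G X)
    (x₀ : X) :
    ∃ c d : ℝ, 0 < c ∧ 0 < d ∧
      ∀ r s : NNReal → X, Isometry r → Isometry s → r 0 = x₀ → s 0 = x₀ →
      ∀ (ε : ℝ) (R : NNReal), dist (r R) (s R) ≤ ε →
      ∃ α β : ℕ → G,
        cs.cayleyGraph.IsGeodesicRay α ∧ cs.cayleyGraph.IsGeodesicRay β ∧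
        α 0 = 1 ∧ β 0 = 1 ∧
        Tracks x₀ (c * ε + d) α r ∧ Tracks x₀ (c * ε + d) β s ∧
        ∃ k : ℕ, (∀ i ≤ k, α i = β i) ∧ (R : ℝ) - c * ε - d ≤ dist x₀ (α k • x₀) := by
  obtain ⟨E, hE0, hE⟩ := IsGeometricAction.exists_dist_simple_le cs x₀
  obtain ⟨C, hC0, hC⟩ := hG.exists_linear_length_bound hX cs x₀
  obtain ⟨δ, htrack⟩ := hG.exists_trackingRay hX hM cs x₀
  have hδ : (0 : ℝ) ≤ δ := δ.coe_nonneg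
  refine ⟨2 * (E * C) + 1, 2 * (E * (C * (4 * δ) + C)) + 2 * δ + E, by positivity, by positivity,
    fun r s hr hs hr0 hs0 ε R hε => ?_⟩
  have hε0 : 0 ≤ ε := dist_nonneg.trans hε
  obtain ⟨α, τ, hα, hτm, hτ0, hατ, hτ, hτu⟩ := htrack r hr hr0
  obtain ⟨β, σ, hβ, -, hσ0, hβσ, hσ, hσu⟩ := htrack s hs hs0
  obtain ⟨n, hn, hnR⟩ := exists_time_le_dist_le hr hτ0 hατ hτ hτu R
  obtain ⟨m, -, hmR⟩ := exists_time_le_dist_le hs hσ0 hβσ hσ hσu R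
  -- The vertices `α n` and `β m` are each within `2 * δ` of `r R` and `s R`, so `K` bounds their
  -- word distance.
  set K : ℝ := C * (4 * δ + ε) + C with hK
  have hEK : 0 ≤ E * K := by positivity
  have huv : (cs.length ((α n)⁻¹ * β m) : ℝ) ≤ K := by
    refine (hC _).trans ?_
    rw [← hG.dist_orbit, hK]
    have h1 := dist_triangle4 (α n • x₀) (r R) (s R) (β m • x₀)
    rw [dist_comm (s R)] at h1
    have h2 := mul_le_mul_of_nonneg_left
      (show dist (α n • x₀) (β m • x₀) ≤ 4 * δ + ε by linarith) hC0.le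
    linarith
  obtain ⟨ω, hωl, hω⟩ := hα.exists_word n
  have hωn : cs.wordProd ω = α n := by
    have := hω n
    rwa [← hωl, List.take_length, hωl, min_self] at this
  have hωred : cs.IsReduced ω := by rw [CoxeterSystem.IsReduced, hωn, hα.length_eq, hωl]
  obtain ⟨υ, hυ, hυe⟩ := cs.exists_isReduced ((α n)⁻¹ * β m)
  have hυl : (υ.length : ℝ) ≤ K := by rwa [← hυ.eq, ← hυe]
  obtain ⟨ω', h1, h2, h3, h4⟩ := hωred.exists_common_prefix hM υ
  rw [hωn] at h1 h2
  rw [← hυe, mul_inv_cancel_left] at h2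
  obtain ⟨γ, hγ, hγi, hγv⟩ := hα.exists_reroute h1
  obtain ⟨γ', hγ', hγi', hγv'⟩ := hβ.exists_reroute h2
  have hu : (cs.length ((cs.wordProd ω')⁻¹ * α n) : ℝ) ≤ K := by
    refine le_trans ?_ hυl
    rw [hα.length_eq] at h1
    exact_mod_cast (by omega)
  have hv : (cs.length ((cs.wordProd ω')⁻¹ * β m) : ℝ) ≤ 2 * K := by
    have h5 := cs.length_mul_le ((cs.wordProd ω')⁻¹ * α n) ((α n)⁻¹ * β m)
    rw [mul_assoc, mul_inv_cancel_left] at h5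
    have h6 : (cs.length ((cs.wordProd ω')⁻¹ * β m) : ℝ) ≤
        cs.length ((cs.wordProd ω')⁻¹ * α n) + cs.length ((α n)⁻¹ * β m) := by exact_mod_cast h5
    linarith
  -- The bound `t ≤ R` matters: only up to `R` is `r` known to be within `ε` of `s`, which lets the
  -- prefix track `s` too.
  have hprefix : ∀ k, ∃ t ≤ R, dist (cs.wordProd (ω'.take k) • x₀) (r t) ≤ E * K + δ := by
    intro k
    obtain ⟨j, e, he, hke⟩ := h4 k
    refine ⟨τ (min j n), (hτm (min_le_right j n)).trans hn, ?_⟩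
    rw [hke, hω]
    have h5 := hG.dist_mul_le hE0.le hE (α (min j n)) (e := e) (K := K)
      (le_trans (by exact_mod_cast he) hυl)
    have h6 := dist_triangle ((α (min j n) * e) • x₀) (α (min j n) • x₀) (r (τ (min j n)))
    have h7 := hατ (min j n)
    linarith
  -- On the right, `E` accounts for an edge, `2 * (E * K)` for the longer rerouted stretch (the one
  -- to `β m`), `2 * δ` for tracking, and `ε` for passing from `r` to `s`.
  have hconst : (2 * (E * C) + 1) * ε + (2 * (E * (C * (4 * δ) + C)) + 2 * δ + E) =
      E + (2 * (E * K) + 2 * δ + ε) := by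
    rw [hK]; ring
  rw [hconst]
  refine ⟨γ, γ', hγ.isGeodesicRay, hγ'.isGeodesicRay, hγ.zero, hγ'.zero,
    hG.tracks_of_vertices hE (by positivity) hγ hr0 fun i => ?_,
    hG.tracks_of_vertices hE (by positivity) hγ' hs0 fun i => ?_,
    ω'.length, fun i hi => by rw [hγi i hi, hγi' i hi], ?_⟩
  · rcases hγv i with ⟨k, hk⟩ | ⟨e, he, hel⟩ | ⟨k, hk⟩
    · obtain ⟨t, -, ht⟩ := hprefix k
      exact ⟨t, by rw [hk]; linarith⟩
    · refine ⟨R, ?_⟩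
      rw [he]
      have h5 := hG.dist_mul_le hE0.le hE (α n) (e := e) (K := K)
        (le_trans (by exact_mod_cast hel) hu)
      have h6 := dist_triangle ((α n * e) • x₀) (α n • x₀) (r R)
      linarith
    · exact ⟨τ k, by rw [hk]; linarith [hατ k]⟩
  · rcases hγv' i with ⟨k, hk⟩ | ⟨e, he, hel⟩ | ⟨k, hk⟩
    · obtain ⟨t, htR, ht⟩ := hprefix k
      refine ⟨t, ?_⟩
      have h5 := hX.dist_rays_le_max hr hs zero_le htR
      rw [hr0, hs0, dist_self] at h5
      have h6 := h5.trans (max_le hε0 hε)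
      have h7 := dist_triangle (γ' i • x₀) (r t) (s t)
      rw [← hk] at ht
      linarith
    · refine ⟨R, ?_⟩
      rw [he]
      have h5 := hG.dist_mul_le hE0.le hE (β m) (e := e) (K := 2 * K)
        (le_trans (by exact_mod_cast hel) hv)
      have h6 := dist_triangle ((β m * e) • x₀) (β m • x₀) (s R)
      linarith
    · exact ⟨σ k, by rw [hk]; linarith [hβσ k]⟩
  · rw [hγi _ le_rfl, List.take_length]
    have h5 := dist_triangle4 (r 0) (cs.wordProd ω' • x₀) (α n • x₀) (r R)
    rw [hr.dist_eq, NNReal.dist_eq, NNReal.coe_zero, zero_sub, abs_neg,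
      abs_of_nonneg R.coe_nonneg, hr0] at h5
    have h6 := hG.dist_mul_le hE0.le hE (cs.wordProd ω')
      (e := (cs.wordProd ω')⁻¹ * α n) (K := K) hu
    rw [mul_inv_cancel_left, dist_comm] at h6
    linarith
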